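/- Let $N$ be a natural number, let $\epsilon>0$ be real, and let $z_1,\dots,z_N\in\mathbb C$ be pairwise distinct; put $Z=\mathrm{diag}(z_1,\dots,z_N)$. Let $\mathrm H_N$ be the real vector space of $N\times N$ complex Hermitian matrices with the flat Lebesgue measure $$\mathrm dM=\prod_{i}\mathrm dM_{ii}\prod_{i<j}\mathrm d(\mathrm{Re}\,M_{ij})\,\mathrm d(\mathrm{Im}\,M_{ij}).$$ Write $\Delta(x_1,\dots,x_N)=\det\big(x_j^{k-1}\big)_{j,k=1}^N=\prod_{1\le j<k\le N}(x_k-x_j)$ for the Vandermonde determinant, and for a Hermitian matrix $A$ with eigenvalues $a_1\le\dots\le a_N$ (with multiplicity) put $\Delta(A)=\Delta(a_1,\dots,a_N)$, so that $\Delta(e^M)/\Delta(M)=\prod_{j<k}\frac{e^{x_k}-e^{x_j}}{x_k-x_j}$ whenever $M\in\mathrm H_N$ has distinct eigenvalues $x_1,\dots,x_N$ (this holds for almost every $M$). Let $\mathrm e^M$ be the matrix exponential, $\cosh M=\frac12(\mathrm e^M+\mathrm e^{-M})$, and let $$\mathrm K_\nu(\zeta)=\int_0^\infty \mathrm e^{-\zeta\cosh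 t}\cosh(\nu t)\,\mathrm dt\qquad(\nu\in\mathbb C,\ \mathrm{Re}\,\zeta>0)$$ be the modified Bessel function of the second kind. Then the function $M\mapsto \exp\mathrm{tr}\big(ZM-\tfrac2\epsilon\cosh M\big)\,\frac{\Delta(e^M)}{\Delta(M)}$ is integrable on $\mathrm H_N$ and $$\int_{\mathrm H_N}\exp\mathrm{tr}\Big(ZM-\frac2\epsilon\cosh M\Big)\,\frac{\Delta(e^M)}{\Delta(M)}\,\mathrm dM \;=\; 2^N\pi^{N(N-1)/2}\,\frac{\det\big(\mathrm K_{z_j+k-1}(2/\epsilon)\big)_{j,k=1}^N}{\Delta(z_1,\dots,z_N)} .$$ -/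

import Mathlib

open MeasureTheory
open scoped Matrix ComplexConjugate

/-- The space `H_N` of `N × N` complex Hermitian matrices. -/
abbrev HermitianMat (N : ℕ) : Type := {M : Matrix (Fin N) (Fin N) ℂ // M.IsHermitian}

/-- The real coordinates of a Hermitian matrix: the (real) diagonal entries, and the
(complex) entries strictly above the diagonal. -/
abbrev HermitianCoords (N : ℕ) : Type :=
  (Fin N → ℝ) × ({p : Fin N × Fin N // p.1 < p.2} → ℂ)

/-- The Hermitian matrix with given diagonal and strictly upper triangular entries. -/
noncomputable def hermitianOfCoords (N : ℕ) : HermitianCoords N ≃ HermitianMat N where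
  toFun c := ⟨Matrix.of fun i j =>
      if h : i < j then c.2 ⟨(i, j), h⟩
      else if h : j < i then conj (c.2 ⟨(j, i), h⟩)
      else (c.1 i : ℂ), by
    ext i j
    rcases lt_trichotomy i j with h | h | h
    · simp [h, h.not_gt]
    · subst h; simp
    · simp [h, h.not_gt]⟩
  invFun M := (fun i => (M.1 i i).re, fun p => M.1 p.1.1 p.1.2)
  left_inv c := by
    refine Prod.ext ?_ ?_
    · funext i; simp
    · funext p; simp [p.2]
  right_inv M := by
    refine Subtype.ext ?_
    ext i j
    rcases lt_trichotomy i j with h | h | h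
    · simp [h]
    · subst h; simpa using M.2.coe_re_apply_self i
    · simpa [h, h.not_gt] using M.2.apply i j

/-- `H_N` carries its Borel σ-algebra (as a subspace of the matrices). -/
noncomputable instance (N : ℕ) : MeasurableSpace (HermitianMat N) := borel _

instance (N : ℕ) : BorelSpace (HermitianMat N) := ⟨rfl⟩

theorem continuous_hermitianOfCoords (N : ℕ) : Continuous (hermitianOfCoords N) := by
  refine Continuous.subtype_mk (continuous_matrix fun i j => ?_) _
  rcases lt_trichotomy i j with h | h | h
  · simp only [Matrix.of_apply, h, dite_true]; fun_prop
  · subst h; simp only [Matrix.of_apply, lt_irrefl, dite_false]; fun_prop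
  · simp only [Matrix.of_apply, h, h.not_gt, dite_true, dite_false]; fun_prop

theorem measurable_hermitianOfCoords (N : ℕ) : Measurable (hermitianOfCoords N) :=
  (continuous_hermitianOfCoords N).measurable

/-- The flat measure `dM = ∏ i, dM_ii ∏ i < j, d(Re M_ij) d(Im M_ij)` on `H_N`. -/
noncomputable def hermitianVolume (N : ℕ) : Measure (HermitianMat N) :=
  Measure.map (hermitianOfCoords N) volume

/-- The hyperbolic cosine of a square matrix. -/
noncomputable def Matrix.coshMat {N : ℕ} (M : Matrix (Fin N) (Fin N) ℂ) :
    Matrix (Fin N) (Fin N) ℂ :=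
  (1 / 2 : ℂ) • (NormedSpace.exp M + NormedSpace.exp (-M))

/-- The Vandermonde determinant `Δ(x_1, …, x_N) = det (x_j ^ (k-1)) = ∏ j < k, (x_k - x_j)`. -/
noncomputable def vandermondeDelta {R : Type*} [CommRing R] {N : ℕ} (x : Fin N → R) : R :=
  (Matrix.vandermonde x).det

/-- The eigenvalues `x_1 ≤ … ≤ x_N` of a Hermitian matrix, with multiplicity, in nondecreasing
order (`eigenvalues₀` lists them in nonincreasing order). -/
noncomputable def sortedEigenvalues {N : ℕ} {A : Matrix (Fin N) (Fin N) ℂ}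
    (hA : A.IsHermitian) (i : Fin N) : ℝ :=
  hA.eigenvalues₀ (Fin.cast (Fintype.card_fin N).symm i.rev)

/-- `Δ(A)` for a Hermitian matrix `A`: the Vandermonde determinant of its eigenvalues, listed in
nondecreasing order (the nonnegative square root of the discriminant of the characteristic
polynomial). -/
noncomputable def Matrix.IsHermitian.delta {N : ℕ} {A : Matrix (Fin N) (Fin N) ℂ}
    (hA : A.IsHermitian) : ℝ :=
  vandermondeDelta (sortedEigenvalues hA)

/-- The modified Bessel function of the second kind `K_ν(ζ)`, of complex order `ν`, for
`Re ζ > 0`: `K_ν(ζ) = ∫_0^∞ exp(-ζ cosh t) cosh(ν t) dt`. -/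
noncomputable def besselK (ν ζ : ℂ) : ℂ :=
  ∫ t in Set.Ioi (0 : ℝ), Complex.exp (-ζ * Complex.cosh t) * Complex.cosh (ν * t)

/-- The integrand `exp tr (Z M - (2/ε) cosh M) · Δ(e^M) / Δ(M)` with `Z = diag(z_1, …, z_N)`. The
quotient is meaningful when `M` has simple spectrum, i.e. off a null set. -/
noncomputable def coshModelIntegrand {N : ℕ} (ε : ℝ) (z : Fin N → ℂ) (M : HermitianMat N) : ℂ :=
  Complex.exp (Matrix.trace
      (Matrix.diagonal z * M.1 - ((2 / ε : ℝ) : ℂ) • Matrix.coshMat M.1))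
    * ((M.2.exp.delta / M.2.delta : ℝ) : ℂ)

/-!
The integral is computed by induction on the size, along the chain of lower right blocks of the
Hermitian matrix, so that neither Haar measure on the unitary group nor the
Harish-Chandra–Itzykson–Zuber formula is needed.

The integrand is `exp (∑ zᵢ Mᵢᵢ)` times a function of the ordered spectrum of `M`
(`coshModelIntegrand_eq`), so only the joint law of the diagonal and of the spectrum matters. Write
`M` as its lower right block `M'`, with eigenvalues `y`, bordered by a row `(a, v)`. In an
eigenbasis of `M'`, which changes `v` by a unitary, the characteristic polynomial of `M` is
`(X - a) ∏ (X - yᵢ) - ∑ rᵢ ∏_{j ≠ i} (X - yⱼ)` with `rᵢ = |vᵢ|²` (`charpoly_borderMatrix`).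
Its values at the `yᵢ`, together with the trace, express `(a, r)` as an explicit polynomial map of
the eigenvalues `x` of `M`. This map is a bijection from the `x` that strictly interlace `y` onto the region `rᵢ > 0`
(`image_borderParams_interlacing`), and its Jacobian is `Δ(x) / Δ(y)`
(`abs_det_borderJacobian`). Since `|vᵢ|²` has law `π dr` on the half-line, the eigenvalues of the
successive blocks form a Gelfand–Tsetlin pattern, distributed according to
`π ^ (N (N - 1) / 2) Δ(x)` times Lebesgue measure, while the diagonal of `M` is the weight of the
pattern: `lintegral_realDiag_sortedEigenvalues`. In particular almost every matrix has simple
spectrum.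

The integral of `exp (∑ zᵢ dᵢ)` over the patterns of weight `d` with top row `x` is
`det (exp (zᵢ xⱼ)) / Δ(z)`. In the induction (`integral_exp_mul_patternMeasure`) the rows
interlaced by `x` form a box, a determinant is integrated over a box column by column, and column
operations identify the result with the determinant of the next size
(`integral_interlacing_det_expMatrix`). Fubini's theorem applies since the weight is controlled by
the top row (`exists_lintegral_patternMeasure_le`) and the hyperbolic cosine beats every
exponential.

What remains is the integral of `det (exp (zᵢ xⱼ)) Δ(e^x) ∏ exp (-(2/ε) cosh xᵢ)` over ordered `x`.
Both determinants are alternating, so expanding the first one turns it into an integral over all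
`x` of a single determinant, whose entries integrate separately
(`integral_det_expMatrix_mul_vandermonde`) to `2 K_{zⱼ + k - 1}(2/ε)`
(`integral_exp_mul_exp_cosh`).
-/

/-! ### Ordered spectrum of a Hermitian matrix -/

section Spectrum

variable {N : ℕ} {A : Matrix (Fin N) (Fin N) ℂ}

theorem sortedEigenvalues_monotone (hA : A.IsHermitian) : Monotone (sortedEigenvalues hA) :=
  fun _ _ hij => hA.eigenvalues₀_antitone (Fin.rev_le_rev.mpr hij)

theorem exists_perm_sortedEigenvalues (hA : A.IsHermitian) :
    ∃ σ : Equiv.Perm (Fin N), sortedEigenvalues hA = hA.eigenvalues ∘ σ := by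
  let e : Fin (Fintype.card (Fin N)) ≃ Fin N :=
    Fintype.equivOfCardEq (Fintype.card_fin _)
  refine ⟨(Fin.revPerm.trans (finCongr (Fintype.card_fin N).symm)).trans e, ?_⟩
  funext i
  simp only [sortedEigenvalues, Matrix.IsHermitian.eigenvalues, Function.comp, Equiv.trans_apply]
  exact congrArg hA.eigenvalues₀ (e.symm_apply_apply _).symm

theorem charpoly_eq_prod_sortedEigenvalues (hA : A.IsHermitian) :
    A.charpoly = ∏ i, (Polynomial.X - Polynomial.C (sortedEigenvalues hA i : ℂ)) := by
  obtain ⟨σ, hσ⟩ := exists_perm_sortedEigenvalues hA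
  rw [hA.charpoly_eq, hσ]
  exact (Equiv.prod_comp σ
    fun i => Polynomial.X - Polynomial.C (hA.eigenvalues i : ℂ)).symm

/-- Two nondecreasing families with the same monic polynomial of roots coincide. -/
theorem eq_of_monotone_of_prod_X_sub_C_eq {x y : Fin N → ℝ} (hx : Monotone x) (hy : Monotone y)
    (h : ∏ i, (Polynomial.X - Polynomial.C (x i : ℂ))
      = ∏ i, (Polynomial.X - Polynomial.C (y i : ℂ))) : x = y := by
  have h' := congrArg Polynomial.roots h
  have key : ∀ w : Fin N → ℝ, (∏ i, (Polynomial.X - Polynomial.C (w i : ℂ))).roots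
      = Multiset.map (fun i => (w i : ℂ)) Finset.univ.val := by
    intro w
    rw [Polynomial.roots_prod _ _
      (by simp [Finset.prod_ne_zero_iff, Polynomial.X_sub_C_ne_zero])]
    simp
  rw [key, key] at h'
  have h2 := congrArg (Multiset.map Complex.re) h'
  simp only [Multiset.map_map, Function.comp_def, Complex.ofReal_re] at h2
  rw [Fin.univ_val_map, Fin.univ_val_map, Multiset.coe_eq_coe] at h2
  exact List.ofFn_inj.mp (h2.eq_of_sortedLE hx.sortedLE_ofFn hy.sortedLE_ofFn)

theorem sortedEigenvalues_eq_of_charpoly (hA : A.IsHermitian) {x : Fin N → ℝ} (hx : Monotone x)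
    (h : A.charpoly = ∏ i, (Polynomial.X - Polynomial.C (x i : ℂ))) :
    sortedEigenvalues hA = x :=
  eq_of_monotone_of_prod_X_sub_C_eq (sortedEigenvalues_monotone hA) hx
    ((charpoly_eq_prod_sortedEigenvalues hA).symm.trans h)

/-- The spectral theorem with the eigenvalues in nondecreasing order. -/
theorem exists_unitary_diagonal_sortedEigenvalues (hA : A.IsHermitian) :
    ∃ U : Matrix (Fin N) (Fin N) ℂ, Uᴴ * U = 1 ∧ U * Uᴴ = 1 ∧
      A = U * Matrix.diagonal (fun i => (sortedEigenvalues hA i : ℂ)) * Uᴴ := by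
  obtain ⟨σ, hσ⟩ := exists_perm_sortedEigenvalues hA
  set V : Matrix (Fin N) (Fin N) ℂ := (hA.eigenvectorUnitary).1 with hV
  have hVV : Vᴴ * V = 1 := Unitary.coe_star_mul_self hA.eigenvectorUnitary
  have hA' : A = V * Matrix.diagonal (fun i => (hA.eigenvalues i : ℂ)) * Vᴴ := by
    have := hA.spectral_theorem
    rw [Unitary.conjStarAlgAut_apply] at this
    exact this
  have h1 : (V.submatrix id σ)ᴴ * V.submatrix id σ = 1 := by
    rw [Matrix.conjTranspose_submatrix,
      ← Matrix.submatrix_mul _ _ _ id _ Function.bijective_id, hVV, Matrix.submatrix_one_equiv]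
  refine ⟨V.submatrix id σ, h1, mul_eq_one_comm.mp h1, ?_⟩
  have hd : Matrix.diagonal (fun i => (sortedEigenvalues hA i : ℂ))
      = (Matrix.diagonal (fun i => (hA.eigenvalues i : ℂ))).submatrix σ σ := by
    rw [Matrix.submatrix_diagonal_equiv, hσ]; rfl
  rw [hd, Matrix.conjTranspose_submatrix, Matrix.submatrix_mul_equiv, Matrix.submatrix_mul_equiv,
    ← hA', Matrix.submatrix_id_id]

theorem charpoly_unitary_conj_diagonal {U : Matrix (Fin N) (Fin N) ℂ} (hU : Uᴴ * U = 1)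
    (d : Fin N → ℂ) : (U * Matrix.diagonal d * Uᴴ).charpoly
      = ∏ i, (Polynomial.X - Polynomial.C (d i)) := by
  rw [Matrix.charpoly_mul_comm, ← mul_assoc, hU, one_mul, Matrix.charpoly_diagonal]

theorem trace_unitary_conj {U : Matrix (Fin N) (Fin N) ℂ} (hU : Uᴴ * U = 1)
    (B : Matrix (Fin N) (Fin N) ℂ) : (U * B * Uᴴ).trace = B.trace := by
  rw [Matrix.trace_mul_comm, ← mul_assoc, hU, one_mul]

theorem exp_unitary_conj_diagonal {U : Matrix (Fin N) (Fin N) ℂ} (hU : U * Uᴴ = 1)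
    (d : Fin N → ℂ) : NormedSpace.exp (U * Matrix.diagonal d * Uᴴ)
      = U * Matrix.diagonal (fun i => Complex.exp (d i)) * Uᴴ := by
  have hinv : U⁻¹ = Uᴴ := Matrix.inv_eq_right_inv hU
  have hunit : IsUnit U := ⟨⟨U, Uᴴ, hU, mul_eq_one_comm.mp hU⟩, rfl⟩
  rw [← hinv, Matrix.exp_conj U _ hunit, Matrix.exp_diagonal]
  congr 3
  funext i
  rw [Pi.coe_exp, Complex.exp_eq_exp_ℂ]

theorem sortedEigenvalues_exp (hA : A.IsHermitian) :
    sortedEigenvalues hA.exp = fun i => Real.exp (sortedEigenvalues hA i) := by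
  obtain ⟨U, hU, hU', h⟩ := exists_unitary_diagonal_sortedEigenvalues hA
  refine sortedEigenvalues_eq_of_charpoly _
    (Real.exp_monotone.comp (sortedEigenvalues_monotone hA)) ?_
  conv_lhs => rw [h, exp_unitary_conj_diagonal hU', charpoly_unitary_conj_diagonal hU]
  simp

theorem trace_coshMat (hA : A.IsHermitian) :
    (Matrix.coshMat A).trace = ∑ i, ((Real.cosh (sortedEigenvalues hA i) : ℝ) : ℂ) := by
  obtain ⟨U, hU, hU', h⟩ := exists_unitary_diagonal_sortedEigenvalues hA
  have hneg : -A = U * Matrix.diagonal (fun i => -(sortedEigenvalues hA i : ℂ)) * Uᴴ := by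
    conv_lhs => rw [h]
    rw [← Matrix.neg_mul, ← Matrix.mul_neg, Matrix.diagonal_neg]
  have e1 : (NormedSpace.exp A).trace = ∑ i, Complex.exp (sortedEigenvalues hA i) := by
    conv_lhs => rw [h, exp_unitary_conj_diagonal hU', trace_unitary_conj hU, Matrix.trace_diagonal]
  have e2 : (NormedSpace.exp (-A)).trace = ∑ i, Complex.exp (-(sortedEigenvalues hA i : ℂ)) := by
    rw [hneg, exp_unitary_conj_diagonal hU', trace_unitary_conj hU, Matrix.trace_diagonal]
  rw [Matrix.coshMat, Matrix.trace_smul, Matrix.trace_add, e1, e2, ← Finset.sum_add_distrib,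
    smul_eq_mul, Finset.mul_sum]
  refine Finset.sum_congr rfl fun i _ => ?_
  rw [Complex.ofReal_cosh, Complex.cosh]; ring

theorem trace_eq_sum_sortedEigenvalues (hA : A.IsHermitian) :
    A.trace = ∑ i, (sortedEigenvalues hA i : ℂ) := by
  obtain ⟨U, hU, hU', h⟩ := exists_unitary_diagonal_sortedEigenvalues hA
  conv_lhs => rw [h, trace_unitary_conj hU, Matrix.trace_diagonal]

theorem trace_mul_self_eq_sum_sortedEigenvalues_sq (hA : A.IsHermitian) :
    (A * A).trace = ∑ i, ((sortedEigenvalues hA i ^ 2 : ℝ) : ℂ) := by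
  obtain ⟨U, hU, hU', h⟩ := exists_unitary_diagonal_sortedEigenvalues hA
  set D := Matrix.diagonal (fun i => (sortedEigenvalues hA i : ℂ))
  have : A * A = U * (D * D) * Uᴴ := by
    calc A * A = (U * D * Uᴴ) * (U * D * Uᴴ) := by rw [← h]
      _ = U * D * (Uᴴ * U) * D * Uᴴ := by simp only [mul_assoc]
      _ = _ := by rw [hU, mul_one]; simp only [mul_assoc]
  rw [this, trace_unitary_conj hU, Matrix.diagonal_mul_diagonal, Matrix.trace_diagonal]
  simp [pow_two]

/-- The ordered eigenvalues depend continuously on the matrix: they are locally bounded, and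
every limit point is a nondecreasing family of roots of the limiting characteristic polynomial. -/
theorem continuous_sortedEigenvalues (N : ℕ) :
    Continuous fun M : HermitianMat N => sortedEigenvalues M.2 := by
  have : FirstCountableTopology (Matrix (Fin N) (Fin N) ℂ) :=
    inferInstanceAs (FirstCountableTopology (Fin N → Fin N → ℂ))
  rw [continuous_iff_seqContinuous]
  intro M L hM
  have hval : Filter.Tendsto (fun n => (M n).1) Filter.atTop (nhds L.1) :=
    (continuous_subtype_val.tendsto L).comp hM
  have hcont : Continuous fun B : Matrix (Fin N) (Fin N) ℂ => ((B * B).trace).re := by fun_prop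
  obtain ⟨R, hR⟩ := ((hcont.tendsto L.1).comp hval).bddAbove_range
  have hbound : ∀ n, sortedEigenvalues (M n).2 ∈
      Metric.closedBall (0 : Fin N → ℝ) (Real.sqrt R) := by
    intro n
    rw [mem_closedBall_zero_iff, pi_norm_le_iff_of_nonneg (Real.sqrt_nonneg _)]
    intro i
    rw [Real.norm_eq_abs]
    refine Real.abs_le_sqrt ?_
    have h1 : (((M n).1 * (M n).1).trace).re = ∑ i, sortedEigenvalues (M n).2 i ^ 2 := by
      rw [trace_mul_self_eq_sum_sortedEigenvalues_sq (M n).2, ← Complex.ofReal_sum,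
        Complex.ofReal_re]
    have h2 : (((M n).1 * (M n).1).trace).re ≤ R := hR ⟨n, rfl⟩
    rw [h1] at h2
    exact (Finset.single_le_sum (f := fun i => sortedEigenvalues (M n).2 i ^ 2)
      (fun i _ => sq_nonneg _) (Finset.mem_univ i)).trans h2
  refine Filter.tendsto_of_subseq_tendsto fun ns hns => ?_
  obtain ⟨x, -, φ, hφ, hx⟩ := tendsto_subseq_of_bounded
    (x := fun n => sortedEigenvalues (M (ns n)).2)
    Metric.isBounded_closedBall (fun n => hbound (ns n))
  refine ⟨φ, ?_⟩
  suffices sortedEigenvalues L.2 = x by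
    change Filter.Tendsto _ _ (nhds (sortedEigenvalues L.2))
    rw [this]; exact hx
  have hxi : ∀ i, Filter.Tendsto (fun n => sortedEigenvalues (M (ns (φ n))).2 i) Filter.atTop
      (nhds (x i)) := fun i => (tendsto_pi_nhds.mp hx) i
  refine sortedEigenvalues_eq_of_charpoly _ (fun i j hij => ?_) (Polynomial.funext fun t => ?_)
  · exact le_of_tendsto_of_tendsto' (hxi i) (hxi j)
      fun n => sortedEigenvalues_monotone (M (ns (φ n))).2 hij
  have hsub : Filter.Tendsto (fun n => (M (ns (φ n))).1) Filter.atTop (nhds L.1) :=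
    hval.comp (hns.comp hφ.tendsto_atTop)
  have hdet : Continuous fun B : Matrix (Fin N) (Fin N) ℂ =>
      (Matrix.scalar (Fin N) t - B).det := by fun_prop
  have lim1 := (hdet.tendsto L.1).comp hsub
  have lim2 : Filter.Tendsto (fun n => ∏ i, (t - (sortedEigenvalues (M (ns (φ n))).2 i : ℂ)))
      Filter.atTop (nhds (∏ i, (t - (x i : ℂ)))) :=
    tendsto_finsetProd _ fun i _ =>
      tendsto_const_nhds.sub ((Complex.continuous_ofReal.tendsto _).comp (hxi i))
  have heq : ∀ n, (Matrix.scalar (Fin N) t - (M (ns (φ n))).1).det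
      = ∏ i, (t - (sortedEigenvalues (M (ns (φ n))).2 i : ℂ)) := by
    intro n
    rw [← Matrix.eval_charpoly, charpoly_eq_prod_sortedEigenvalues (M (ns (φ n))).2,
      Polynomial.eval_prod]
    simp
  rw [Matrix.eval_charpoly, Polynomial.eval_prod]
  simp only [Polynomial.eval_sub, Polynomial.eval_X, Polynomial.eval_C]
  exact tendsto_nhds_unique (lim1.congr heq) lim2

end Spectrum

/-! ### Bordering a Hermitian matrix -/

section Border

variable {N : ℕ}

/-- The matrix `!![a, v; v*, M]`: a row and a column are added to `M` in front. -/
noncomputable def borderMatrix (a : ℝ) (v : Fin N → ℂ) (M : Matrix (Fin N) (Fin N) ℂ) :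
    Matrix (Fin (N + 1)) (Fin (N + 1)) ℂ :=
  Matrix.of (Fin.cons (Fin.cons (a : ℂ) v) fun i => Fin.cons (conj (v i)) (M i))

theorem borderMatrix_isHermitian (a : ℝ) (v : Fin N → ℂ) {M : Matrix (Fin N) (Fin N) ℂ}
    (hM : M.IsHermitian) : (borderMatrix a v M).IsHermitian := by
  ext i j
  refine Fin.cases ?_ (fun i => ?_) i <;> refine Fin.cases ?_ (fun j => ?_) j <;>
    simp [borderMatrix]
  exact hM.apply i j

/-- `borderMatrix` as a Hermitian matrix. -/
noncomputable def border (a : ℝ) (v : Fin N → ℂ) (M : HermitianMat N) : HermitianMat (N + 1) :=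
  ⟨borderMatrix a v M.1, borderMatrix_isHermitian a v M.2⟩

instance (N : ℕ) : SecondCountableTopology (HermitianMat N) := by
  have : SecondCountableTopology (Matrix (Fin N) (Fin N) ℂ) :=
    inferInstanceAs (SecondCountableTopology (Fin N → Fin N → ℂ))
  exact TopologicalSpace.Subtype.secondCountableTopology _

theorem continuous_border : Continuous
    fun q : HermitianMat N × ℝ × (Fin N → ℂ) => border q.2.1 q.2.2 q.1 := by
  refine Continuous.subtype_mk (continuous_matrix fun i j => ?_) _
  refine Fin.cases ?_ (fun i => ?_) i <;> refine Fin.cases ?_ (fun j => ?_) j <;>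
    simp only [borderMatrix, Matrix.of_apply, Fin.cons_zero, Fin.cons_succ]
  · fun_prop
  · fun_prop
  · exact Complex.continuous_conj.comp (by fun_prop)
  · exact (continuous_subtype_val.comp continuous_fst).matrix_elem i j

/-- The positions above the diagonal of a matrix of size `N + 1`: those in the first row, and
those of the lower right block. -/
def upperIndexEquiv (N : ℕ) : Fin N ⊕ {p : Fin N × Fin N // p.1 < p.2} ≃
    {p : Fin (N + 1) × Fin (N + 1) // p.1 < p.2} where
  toFun := Sum.elim (fun j => ⟨(0, j.succ), Fin.succ_pos j⟩)
    fun p => ⟨(p.1.1.succ, p.1.2.succ), Fin.succ_lt_succ_iff.mpr p.2⟩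
  invFun p := if h : p.1.1 = 0 then Sum.inl (p.1.2.pred (Fin.ne_zero_of_lt p.2)) else
    Sum.inr ⟨(p.1.1.pred h, p.1.2.pred (Fin.ne_zero_of_lt p.2)), (Fin.pred_lt_pred_iff (ha := h) (hb := Fin.ne_zero_of_lt p.2)).mpr p.2⟩
  left_inv s := by
    rcases s with j | p
    · simp
    · simp [Fin.succ_ne_zero]
  right_inv p := by
    obtain ⟨⟨i, j⟩, h⟩ := p
    by_cases hi : i = 0
    · subst hi; simp
    · simp [hi]

/-- Coordinates of a bordered matrix from those of its pieces. -/
noncomputable def borderCoords (N : ℕ) : (ℝ × (Fin N → ℝ)) × ((Fin N → ℂ) ×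
    ({p : Fin N × Fin N // p.1 < p.2} → ℂ)) → HermitianCoords (N + 1) :=
  Prod.map (MeasurableEquiv.piFinSuccAbove (fun _ : Fin (N + 1) => ℝ) 0).symm
    ((MeasurableEquiv.piCongrLeft (fun _ => ℂ) (upperIndexEquiv N)) ∘
      (MeasurableEquiv.sumPiEquivProdPi fun _ => ℂ).symm)

theorem measurePreserving_borderCoords (N : ℕ) : MeasurePreserving (borderCoords N) :=
  ((volume_preserving_piFinSuccAbove (fun _ : Fin (N + 1) => ℝ) 0).symm).prod
    ((volume_measurePreserving_piCongrLeft (fun _ => ℂ) (upperIndexEquiv N)).comp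
      (volume_measurePreserving_sumPiEquivProdPi_symm fun _ => ℂ))

theorem hermitianOfCoords_borderCoords (a : ℝ) (d : Fin N → ℝ) (v : Fin N → ℂ)
    (u : {p : Fin N × Fin N // p.1 < p.2} → ℂ) :
    hermitianOfCoords (N + 1) (borderCoords N ((a, d), (v, u))) =
      border a v (hermitianOfCoords N (d, u)) := by
  have hv : ∀ j : Fin N, (borderCoords N ((a, d), (v, u))).2 ⟨(0, j.succ), Fin.succ_pos j⟩ = v j :=
    fun j => Equiv.piCongrLeft_apply_apply (fun _ => ℂ) (upperIndexEquiv N)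
      ((MeasurableEquiv.sumPiEquivProdPi fun _ => ℂ).symm (v, u)) (Sum.inl j)
  have hu : ∀ (i j : Fin N) (h : i < j), (borderCoords N ((a, d), (v, u))).2
      ⟨(i.succ, j.succ), Fin.succ_lt_succ_iff.mpr h⟩ = u ⟨(i, j), h⟩ :=
    fun i j h => Equiv.piCongrLeft_apply_apply (fun _ => ℂ) (upperIndexEquiv N)
      ((MeasurableEquiv.sumPiEquivProdPi fun _ => ℂ).symm (v, u)) (Sum.inr ⟨(i, j), h⟩)
  have h0 : (borderCoords N ((a, d), (v, u))).1 0 = a := rfl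
  have hd : ∀ i : Fin N, (borderCoords N ((a, d), (v, u))).1 i.succ = d i := fun i => rfl
  refine Subtype.ext ?_
  ext i j
  refine Fin.cases ?_ (fun i => ?_) i <;> refine Fin.cases ?_ (fun j => ?_) j
  · simp [hermitianOfCoords, border, borderMatrix, h0]
  · simp [hermitianOfCoords, border, borderMatrix, hv]
  · simp [hermitianOfCoords, border, borderMatrix, hv]
  · rcases lt_trichotomy i j with h | h | h
    · simp [hermitianOfCoords, border, borderMatrix, h, hu]
    · subst h; simp [hermitianOfCoords, border, borderMatrix, hd]
    · simp [hermitianOfCoords, border, borderMatrix, h, h.not_gt, hu]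

instance (N : ℕ) : SFinite (hermitianVolume N) := by
  unfold hermitianVolume; infer_instance

/-- Integration over Hermitian matrices of size `N + 1`, by the lower right block, the corner
entry and the rest of the first row. -/
theorem lintegral_hermitianVolume_succ {f : HermitianMat (N + 1) → ENNReal} (hf : Measurable f) :
    ∫⁻ M, f M ∂hermitianVolume (N + 1) =
      ∫⁻ M, (∫⁻ a : ℝ, ∫⁻ v : Fin N → ℂ, f (border a v M)) ∂hermitianVolume N := by
  have hmeas : Measurable fun q : HermitianMat N × ℝ × (Fin N → ℂ) => f (border q.2.1 q.2.2 q.1) :=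
    hf.comp continuous_border.measurable
  have hH := measurable_hermitianOfCoords N
  have hin : Measurable fun M : HermitianMat N =>
      ∫⁻ a : ℝ, ∫⁻ v : Fin N → ℂ, f (border a v M) := by
    have h3 : Measurable fun q : (HermitianMat N × ℝ) × (Fin N → ℂ) =>
        f (border q.1.2 q.2 q.1.1) := hmeas.comp (by fun_prop :
          Measurable fun q : (HermitianMat N × ℝ) × (Fin N → ℂ) => (q.1.1, q.1.2, q.2))
    exact h3.lintegral_prod_right'.lintegral_prod_right'
  have hJ : Measurable fun q : (ℝ × (Fin N → ℝ)) × ((Fin N → ℂ) ×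
      ({p : Fin N × Fin N // p.1 < p.2} → ℂ)) =>
      f (border q.1.1 q.2.1 (hermitianOfCoords N (q.1.2, q.2.2))) :=
    hmeas.comp ((hH.comp (by fun_prop : Measurable fun q : (ℝ × (Fin N → ℝ)) × ((Fin N → ℂ) ×
      ({p : Fin N × Fin N // p.1 < p.2} → ℂ)) => (q.1.2, q.2.2))).prodMk
        (by fun_prop : Measurable fun q : (ℝ × (Fin N → ℝ)) × ((Fin N → ℂ) ×
      ({p : Fin N × Fin N // p.1 < p.2} → ℂ)) => (q.1.1, q.2.1)))
  rw [hermitianVolume, hermitianVolume, lintegral_map hf (measurable_hermitianOfCoords _),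
    lintegral_map hin hH]
  have e0 := (measurePreserving_borderCoords N).lintegral_comp
    (hf.comp (measurable_hermitianOfCoords (N + 1)))
  simp only [Function.comp_apply] at e0
  rw [← e0]
  have e1 : ∀ q : (ℝ × (Fin N → ℝ)) × ((Fin N → ℂ) × ({p : Fin N × Fin N // p.1 < p.2} → ℂ)),
      f (hermitianOfCoords (N + 1) (borderCoords N q)) =
        f (border q.1.1 q.2.1 (hermitianOfCoords N (q.1.2, q.2.2))) := fun q => by
    rw [← hermitianOfCoords_borderCoords]
  simp only [e1]
  have e5 : ∫⁻ c : HermitianCoords N, ∫⁻ a : ℝ, ∫⁻ v : Fin N → ℂ,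
      f (border a v (hermitianOfCoords N c)) = ∫⁻ d : Fin N → ℝ,
        ∫⁻ u : {p : Fin N × Fin N // p.1 < p.2} → ℂ, ∫⁻ a : ℝ, ∫⁻ v : Fin N → ℂ,
          f (border a v (hermitianOfCoords N (d, u))) :=
    lintegral_prod (fun c => ∫⁻ a : ℝ, ∫⁻ v : Fin N → ℂ, f (border a v (hermitianOfCoords N c)))
      (hin.comp hH).aemeasurable
  rw [Measure.volume_eq_prod, lintegral_prod _ hJ.aemeasurable, Measure.volume_eq_prod,
    lintegral_prod_symm _ (by exact hJ.lintegral_prod_right'.aemeasurable), e5]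
  refine lintegral_congr fun d => ?_
  have e2 : ∀ a : ℝ, ∫⁻ q : (Fin N → ℂ) × ({p : Fin N × Fin N // p.1 < p.2} → ℂ),
      f (border a q.1 (hermitianOfCoords N (d, q.2))) =
      ∫⁻ u : {p : Fin N × Fin N // p.1 < p.2} → ℂ, ∫⁻ v : Fin N → ℂ,
        f (border a v (hermitianOfCoords N (d, u))) := fun a => by
    refine lintegral_prod_symm _ ?_
    exact (hJ.comp (by fun_prop : Measurable fun q : (Fin N → ℂ) ×
      ({p : Fin N × Fin N // p.1 < p.2} → ℂ) => ((a, d), q))).aemeasurable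
  rw [lintegral_congr e2, lintegral_lintegral_swap]
  have h4 : Measurable fun q : (ℝ × ({p : Fin N × Fin N // p.1 < p.2} → ℂ)) × (Fin N → ℂ) =>
      f (border q.1.1 q.2 (hermitianOfCoords N (d, q.1.2))) :=
    hJ.comp (by fun_prop : Measurable fun q : (ℝ × ({p : Fin N × Fin N // p.1 < p.2} → ℂ)) ×
      (Fin N → ℂ) => ((q.1.1, d), (q.2, q.1.2)))
  exact h4.lintegral_prod_right'.aemeasurable

end Border

/-! ### The spectrum of a bordered matrix -/

section Arrow

variable {N : ℕ}

/-- The polynomial `(X - a) ∏ᵢ (X - yᵢ) - ∑ᵢ rᵢ ∏_{j ≠ i} (X - yⱼ)`. It is the characteristic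
polynomial of a bordered matrix with corner `a` whose lower right block has eigenvalues `y`, when
`rᵢ` is the squared modulus of the `i`-th component of the border in the eigenbasis. -/
noncomputable def arrowPoly (y : Fin N → ℝ) (a : ℝ) (r : Fin N → ℝ) : Polynomial ℝ :=
  (Polynomial.X - Polynomial.C a) * ∏ i, (Polynomial.X - Polynomial.C (y i)) -
    ∑ i, Polynomial.C (r i) * ∏ j ∈ Finset.univ.erase i, (Polynomial.X - Polynomial.C (y j))

theorem eval_arrowPoly_apply (y : Fin N → ℝ) (a : ℝ) (r : Fin N → ℝ) (i : Fin N) :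
    (arrowPoly y a r).eval (y i) = -(r i * ∏ j ∈ Finset.univ.erase i, (y i - y j)) := by
  rw [arrowPoly, Polynomial.eval_sub, Polynomial.eval_mul, Polynomial.eval_prod,
    Polynomial.eval_finsetSum, Finset.prod_eq_zero (Finset.mem_univ i) (by simp),
    Finset.sum_eq_single i]
  · simp [Polynomial.eval_prod]
  · intro k _ hk
    rw [Polynomial.eval_mul, Polynomial.eval_prod,
      Finset.prod_eq_zero (Finset.mem_erase.mpr ⟨hk.symm, Finset.mem_univ i⟩) (by simp), mul_zero]
  · simp

theorem degree_sum_arrow_lt (y r : Fin N → ℝ) :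
    (∑ i, Polynomial.C (r i) * ∏ j ∈ Finset.univ.erase i,
      (Polynomial.X - Polynomial.C (y j))).degree < N := by
  refine (Polynomial.degree_sum_le _ _).trans_lt ?_
  refine (Finset.sup_lt_iff (WithBot.bot_lt_coe N)).mpr fun i _ => ?_
  refine (Polynomial.degree_mul_le _ _).trans_lt ?_
  refine (add_le_add Polynomial.degree_C_le le_rfl).trans_lt ?_
  rw [zero_add, Polynomial.degree_prod]
  simp only [Polynomial.degree_X_sub_C, Finset.sum_const, Finset.card_erase_of_mem (Finset.mem_univ i),
    Finset.card_univ, Fintype.card_fin, nsmul_eq_mul, mul_one]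
  have : N - 1 < N := Nat.sub_lt (Fin.pos i) one_pos
  exact Nat.cast_lt.mpr this

/-- Two monic products of linear factors with the same number of factors and the same sum of roots
differ in degree by at least two. -/
theorem degree_prod_sub_prod_lt (x : Fin (N + 1) → ℝ) (y : Fin N → ℝ) {a : ℝ}
    (ha : a = ∑ k, x k - ∑ i, y i) :
    ((∏ k, (Polynomial.X - Polynomial.C (x k))) -
      (Polynomial.X - Polynomial.C a) * ∏ i, (Polynomial.X - Polynomial.C (y i))).degree < (N : WithBot ℕ) := by
  have hcons : (Polynomial.X - Polynomial.C a) * ∏ i, (Polynomial.X - Polynomial.C (y i))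
      = ∏ k, (Polynomial.X - Polynomial.C ((Fin.cons a y : Fin (N + 1) → ℝ) k)) := by
    rw [Fin.prod_univ_succ]; simp
  rw [hcons]
  have hdeg : ∀ w : Fin (N + 1) → ℝ,
      (∏ k, (Polynomial.X - Polynomial.C (w k))).natDegree = N + 1 := by
    intro w
    rw [Polynomial.natDegree_prod_of_monic _ _ fun k _ => Polynomial.monic_X_sub_C (w k)]
    simp
  have hlead : ∀ w : Fin (N + 1) → ℝ,
      (∏ k, (Polynomial.X - Polynomial.C (w k))).coeff (N + 1) = 1 := by
    intro w
    have := Polynomial.monic_prod_of_monic Finset.univ _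
      fun k _ => Polynomial.monic_X_sub_C (w k)
    rw [Polynomial.Monic, Polynomial.leadingCoeff, hdeg] at this
    exact this
  have hnext : ∀ w : Fin (N + 1) → ℝ,
      (∏ k, (Polynomial.X - Polynomial.C (w k))).coeff N = -∑ k, w k := by
    intro w
    have := Polynomial.prod_X_sub_C_nextCoeff (s := Finset.univ) w
    rw [Polynomial.nextCoeff_of_natDegree_pos (by rw [hdeg]; omega), hdeg] at this
    exact this
  rw [Polynomial.degree_lt_iff_coeff_zero]
  intro m hm
  rw [Polynomial.coeff_sub, sub_eq_zero]
  rcases lt_trichotomy m (N + 1) with h | h | h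
  · obtain rfl : m = N := by omega
    rw [hnext, hnext, Fin.sum_univ_succ (Fin.cons a y)]
    simp [ha]
  · rw [h, hlead, hlead]
  · rw [Polynomial.coeff_eq_zero_of_natDegree_lt (by rw [hdeg]; exact h),
      Polynomial.coeff_eq_zero_of_natDegree_lt (by rw [hdeg]; exact h)]

/-- The corner entry and the squared border entries of an arrow matrix, as functions of its
eigenvalues `x`, when the block has the eigenvalues `y`. -/
noncomputable def borderParams (y : Fin N → ℝ) (x : Fin (N + 1) → ℝ) : Fin (N + 1) → ℝ :=
  Fin.cons (∑ k, x k - ∑ i, y i)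
    fun i => -(∏ k, (y i - x k)) / ∏ j ∈ Finset.univ.erase i, (y i - y j)

theorem prod_erase_sub_ne_zero {y : Fin N → ℝ} (hy : Function.Injective y) (i : Fin N) :
    ∏ j ∈ Finset.univ.erase i, (y i - y j) ≠ 0 :=
  Finset.prod_ne_zero_iff.mpr fun _ hj =>
    sub_ne_zero.mpr fun h => (Finset.ne_of_mem_erase hj) (hy h).symm

/-- Lagrange interpolation at the nodes `y`: a family is recovered from its `borderParams`. -/
theorem arrowPoly_borderParams {y : Fin N → ℝ} (hy : Function.Injective y) (x : Fin (N + 1) → ℝ) :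
    arrowPoly y (borderParams y x 0) (fun i => borderParams y x i.succ) =
      ∏ k, (Polynomial.X - Polynomial.C (x k)) := by
  refine (Polynomial.eq_of_degree_sub_lt_of_eval_finset_eq (Finset.univ.image y) ?_ ?_).symm
  · rw [Finset.card_image_of_injective _ hy, Finset.card_univ, Fintype.card_fin, arrowPoly,
      ← sub_add]
    exact (Polynomial.degree_add_le _ _).trans_lt
      (max_lt (degree_prod_sub_prod_lt x y rfl) (degree_sum_arrow_lt y _))
  · intro t ht
    obtain ⟨i, -, rfl⟩ := Finset.mem_image.mp ht
    rw [eval_arrowPoly_apply, borderParams, Fin.cons_succ,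
      div_mul_cancel₀ _ (prod_erase_sub_ne_zero hy i), neg_neg, Polynomial.eval_prod]
    simp

/-- The determinant of an invertible matrix bordered by a row and a column. -/
theorem det_border_of_inverse (b : ℂ) (u w : Fin N → ℂ) {B B' : Matrix (Fin N) (Fin N) ℂ}
    (hB : B' * B = 1) :
    (Matrix.of (Fin.cons (Fin.cons b u) fun i => Fin.cons (w i) (B i)) :
      Matrix (Fin (N + 1)) (Fin (N + 1)) ℂ).det = B.det * (b - u ⬝ᵥ B' *ᵥ w) := by
  let e : Fin N ⊕ Unit ≃ Fin (N + 1) :=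
    (Equiv.optionEquivSumPUnit _).symm.trans (finSuccEquiv N).symm
  let _ : Invertible B := ⟨B', hB, mul_eq_one_comm.mp hB⟩
  rw [← Matrix.det_submatrix_equiv_self e]
  have : (Matrix.of (Fin.cons (Fin.cons b u) fun i => Fin.cons (w i) (B i)) :
      Matrix (Fin (N + 1)) (Fin (N + 1)) ℂ).submatrix e e = Matrix.fromBlocks B
        (Matrix.replicateCol Unit w) (Matrix.replicateRow Unit u) (Matrix.of fun _ _ => b) := by
    ext (i | i) (j | j) <;> simp [e]
  rw [this, Matrix.det_fromBlocks₁₁, Matrix.det_unique (n := Unit)]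
  have hinv : ⅟B = B' := rfl
  rw [hinv]
  simp [Matrix.mul_assoc, Matrix.mul_apply, dotProduct, Matrix.mulVec]

/-- The characteristic polynomial of a bordered matrix, from the Schur complement of the block. -/
theorem charpoly_borderMatrix (a : ℝ) (v : Fin N → ℂ) (y : Fin N → ℝ)
    {U : Matrix (Fin N) (Fin N) ℂ} (hU : Uᴴ * U = 1) (hU' : U * Uᴴ = 1) :
    (borderMatrix a v (U * Matrix.diagonal (fun i => (y i : ℂ)) * Uᴴ)).charpoly =
      (arrowPoly y a fun i => ‖(v ᵥ* U) i‖ ^ 2).map Complex.ofRealHom := by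
  refine Polynomial.eq_of_infinite_eval_eq _ _ ?_
  refine Set.Infinite.mono (s := (Set.range fun i => (y i : ℂ))ᶜ) ?_
    (Set.finite_range _).infinite_compl
  intro t ht
  have hne : ∀ i, t - y i ≠ 0 := fun i h => ht ⟨i, (sub_eq_zero.mp h).symm⟩
  have hBeq : Matrix.scalar (Fin N) t - U * Matrix.diagonal (fun i => (y i : ℂ)) * Uᴴ
      = U * Matrix.diagonal (fun i => t - y i) * Uᴴ := by
    rw [← Matrix.diagonal_sub, Matrix.mul_sub, Matrix.sub_mul]
    congr 1
    have : Matrix.diagonal (fun _ : Fin N => t) = t • (1 : Matrix (Fin N) (Fin N) ℂ) := by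
      rw [Matrix.smul_one_eq_diagonal]
    rw [Matrix.scalar_apply, this]
    simp [hU']
  have hB' : (U * Matrix.diagonal (fun i => (t - y i)⁻¹) * Uᴴ) *
      (Matrix.scalar (Fin N) t - U * Matrix.diagonal (fun i => (y i : ℂ)) * Uᴴ) = 1 := by
    rw [hBeq]
    calc (U * Matrix.diagonal (fun i => (t - y i)⁻¹) * Uᴴ) *
        (U * Matrix.diagonal (fun i => t - y i) * Uᴴ)
        = U * (Matrix.diagonal (fun i => (t - y i)⁻¹) * (Uᴴ * U) *
          Matrix.diagonal (fun i => t - y i)) * Uᴴ := by simp only [mul_assoc]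
      _ = 1 := by
        rw [hU, mul_one, Matrix.diagonal_mul_diagonal]
        simp [hne, hU']
  have hdet : (Matrix.scalar (Fin N) t - U * Matrix.diagonal (fun i => (y i : ℂ)) * Uᴴ).det
      = ∏ i, (t - y i) := by
    rw [hBeq, Matrix.det_mul_comm, ← mul_assoc, hU, one_mul, Matrix.det_diagonal]
  have hform : Matrix.scalar (Fin (N + 1)) t -
      borderMatrix a v (U * Matrix.diagonal (fun i => (y i : ℂ)) * Uᴴ) =
      Matrix.of (Fin.cons (Fin.cons (t - a) (-v)) fun i => Fin.cons (-conj (v i))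
        ((Matrix.scalar (Fin N) t - U * Matrix.diagonal (fun i => (y i : ℂ)) * Uᴴ) i)) := by
    ext i j
    refine Fin.cases ?_ (fun i => ?_) i <;> refine Fin.cases ?_ (fun j => ?_) j
    · simp [borderMatrix]
    · simp [borderMatrix, (Fin.succ_ne_zero j).symm]
    · simp [borderMatrix]
    · simp [borderMatrix, Matrix.diagonal_apply]
  have hquad : (-v) ⬝ᵥ (U * Matrix.diagonal (fun i => (t - y i)⁻¹) * Uᴴ) *ᵥ (fun i => -conj (v i))
      = ∑ i, ((‖(v ᵥ* U) i‖ ^ 2 : ℝ) : ℂ) * (t - y i)⁻¹ := by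
    have hw : Uᴴ *ᵥ (fun i => -conj (v i)) = -star (v ᵥ* U) := by
      rw [Matrix.star_vecMul, ← Matrix.mulVec_neg]; rfl
    rw [← Matrix.mulVec_mulVec, ← Matrix.mulVec_mulVec, hw, Matrix.dotProduct_mulVec,
      Matrix.neg_vecMul, Matrix.mulVec_neg, neg_dotProduct_neg]
    simp only [dotProduct, Matrix.mulVec_diagonal, Pi.star_apply]
    refine Finset.sum_congr rfl fun i _ => ?_
    push_cast
    rw [← Complex.mul_conj']
    simp only [RCLike.star_def]
    ring
  show _ = _
  rw [Matrix.eval_charpoly, hform, det_border_of_inverse _ _ _ hB', hdet, hquad,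
    Polynomial.eval_map, arrowPoly]
  simp only [Polynomial.eval₂_sub, Polynomial.eval₂_mul, Polynomial.eval₂_finsetSum,
    Polynomial.eval₂_finsetProd, Polynomial.eval₂_X, Polynomial.eval₂_C, Complex.ofRealHom_eq_coe]
  rw [mul_sub, mul_comm, Finset.mul_sum]
  congr 1
  refine Finset.sum_congr rfl fun i _ => ?_
  rw [← Finset.mul_prod_erase _ _ (Finset.mem_univ i)]
  field_simp [hne i]

end Arrow

/-! ### Interlacing families -/

section Interlacing

variable {N : ℕ}

/-- The families `x` of `N + 1` reals that strictly interlace a family `y` of `N` reals: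
`x₀ < y₀ < x₁ < y₁ < ⋯ < y_{N-1} < x_N`. -/
def interlacing (y : Fin N → ℝ) : Set (Fin (N + 1) → ℝ) :=
  {x | ∀ i : Fin N, x i.castSucc < y i ∧ y i < x i.succ}

theorem strictMono_of_mem_interlacing {y : Fin N → ℝ} {x : Fin (N + 1) → ℝ}
    (h : x ∈ interlacing y) : StrictMono x :=
  Fin.strictMono_iff_lt_succ.mpr fun i => (h i).1.trans (h i).2

theorem isOpen_setOf_interlacing (N : ℕ) :
    IsOpen {p : (Fin N → ℝ) × (Fin (N + 1) → ℝ) | p.2 ∈ interlacing p.1} := by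
  have h : {p : (Fin N → ℝ) × (Fin (N + 1) → ℝ) | p.2 ∈ interlacing p.1} =
      ⋂ i : Fin N, {p | p.2 i.castSucc < p.1 i ∧ p.1 i < p.2 i.succ} := by
    ext p; simp [interlacing]
  rw [h]
  refine isOpen_iInter_of_finite fun i => ?_
  exact (isOpen_lt (f := fun p : (Fin N → ℝ) × (Fin (N + 1) → ℝ) => p.2 i.castSucc)
    (g := fun p => p.1 i) (by fun_prop) (by fun_prop)).inter
    (isOpen_lt (f := fun p : (Fin N → ℝ) × (Fin (N + 1) → ℝ) => p.1 i)
    (g := fun p => p.2 i.succ) (by fun_prop) (by fun_prop))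

theorem isOpen_interlacing (y : Fin N → ℝ) : IsOpen (interlacing y) :=
  (isOpen_setOf_interlacing N).preimage (Continuous.prodMk_right y)

/-- The sign of a product is given by the parity of the number of negative factors. -/
theorem neg_one_pow_card_mul_prod_pos {ι : Type*} (s : Finset ι) (t : ι → ℝ)
    (ht : ∀ k ∈ s, t k ≠ 0) : 0 < (-1 : ℝ) ^ (s.filter fun k => t k < 0).card * ∏ k ∈ s, t k := by
  classical
  induction s using Finset.induction_on with
  | empty => simp
  | insert a s ha ih =>
    have ih' := ih fun k hk => ht k (Finset.mem_insert_of_mem hk)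
    rw [Finset.prod_insert ha, Finset.filter_insert]
    rcases lt_or_gt_of_ne (ht a (Finset.mem_insert_self a s)) with h | h
    · rw [if_pos h, Finset.card_insert_of_notMem (by simp [ha]), pow_succ]
      nlinarith [mul_pos ih' (neg_pos.mpr h)]
    · rw [if_neg h.not_gt]
      nlinarith [mul_pos ih' h]

theorem neg_one_pow_mul_prod_erase_pos {y : Fin N → ℝ} (hy : StrictMono y) (i : Fin N) :
    0 < (-1 : ℝ) ^ (N - 1 - (i : ℕ)) * ∏ j ∈ Finset.univ.erase i, (y i - y j) := by
  have h := neg_one_pow_card_mul_prod_pos (Finset.univ.erase i) (fun j => y i - y j)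
    fun j hj => sub_ne_zero.mpr fun h => (Finset.ne_of_mem_erase hj) (hy.injective h).symm
  have hset : (Finset.univ.erase i).filter (fun j => y i - y j < 0) = Finset.Ioi i := by
    ext j
    simp only [Finset.mem_filter, Finset.mem_erase, Finset.mem_univ, and_true, sub_neg,
      hy.lt_iff_lt, Finset.mem_Ioi]
    exact ⟨fun h => h.2, fun h => ⟨h.ne', h⟩⟩
  rwa [hset, Fin.card_Ioi] at h

theorem borderParams_succ_pos_of_mem_interlacing {y : Fin N → ℝ} (hy : StrictMono y)
    {x : Fin (N + 1) → ℝ} (hx : x ∈ interlacing y) (i : Fin N) :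
    0 < borderParams y x i.succ := by
  have hxm := strictMono_of_mem_interlacing hx
  have hlt : ∀ k : Fin (N + 1), y i < x k ↔ i.castSucc < k := by
    intro k
    constructor
    · intro h
      by_contra! hk
      exact absurd ((hxm.monotone hk).trans_lt (hx i).1) h.not_gt
    · intro h
      exact (hx i).2.trans_le (hxm.monotone (Fin.castSucc_lt_iff_succ_le.mp h))
  have h := neg_one_pow_card_mul_prod_pos Finset.univ (fun k => y i - x k) fun k _ => by
    rcases lt_or_ge i.castSucc k with hk | hk
    · exact (sub_neg.mpr ((hlt k).mpr hk)).ne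
    · exact (sub_pos.mpr ((hxm.monotone hk).trans_lt (hx i).1)).ne'
  have hset : Finset.univ.filter (fun k => y i - x k < 0) = Finset.Ioi i.castSucc := by
    ext k
    simp [hlt]
  rw [hset, Fin.card_Ioi] at h
  have hD := neg_one_pow_mul_prod_erase_pos hy i
  have hpow : (-1 : ℝ) ^ (N + 1 - 1 - ((i.castSucc : Fin (N + 1)) : ℕ))
      = -(-1) ^ (N - 1 - (i : ℕ)) := by
    have : N + 1 - 1 - ((i.castSucc : Fin (N + 1)) : ℕ) = (N - 1 - (i : ℕ)) + 1 := by
      have := i.2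
      simp only [Fin.val_castSucc]; omega
    rw [this, pow_succ]; ring
  rw [hpow] at h
  rw [borderParams, Fin.cons_succ]
  have hs : ((-1 : ℝ) ^ (N - 1 - (i : ℕ))) ≠ 0 := pow_ne_zero _ (by norm_num)
  rw [← mul_div_mul_left _ _ hs]
  exact div_pos (by linarith) hD

/-- If the squared border entries are positive, the eigenvalues interlace strictly. The number of
`xₖ` below `yᵢ` has the parity of `i + 1`, and it is nondecreasing in `i`, hence equal to
`i + 1`. -/
theorem mem_interlacing_of_borderParams_pos {y : Fin N → ℝ} (hy : StrictMono y)
    {x : Fin (N + 1) → ℝ} (hx : Monotone x) (hpos : ∀ i : Fin N, 0 < borderParams y x i.succ) :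
    x ∈ interlacing y := by
  have hprod : ∀ i : Fin N, 0 < (-1 : ℝ) ^ (N - 1 - (i : ℕ)) * -∏ k, (y i - x k) := by
    intro i
    have h := mul_pos (hpos i) (neg_one_pow_mul_prod_erase_pos hy i)
    rw [borderParams, Fin.cons_succ, mul_left_comm,
      div_mul_cancel₀ _ (prod_erase_sub_ne_zero hy.injective i)] at h
    exact h
  have hne : ∀ i k, y i - x k ≠ 0 := by
    intro i k h
    have := hprod i
    rw [Finset.prod_eq_zero (Finset.mem_univ k) h] at this
    simp at this
  set c : Fin N → ℕ := fun i => (Finset.univ.filter fun k => x k < y i).card with hc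
  have hcompl : ∀ i, (Finset.univ.filter fun k => y i - x k < 0).card + c i = N + 1 := by
    intro i
    have h1 : Finset.univ.filter (fun k => x k < y i)
        = Finset.univ.filter (fun k => ¬ (y i - x k < 0)) := by
      ext k
      simp only [Finset.mem_filter, Finset.mem_univ, true_and, sub_neg, not_lt]
      exact ⟨le_of_lt, fun h => lt_of_le_of_ne h fun h' => hne i k (by rw [h', sub_self])⟩
    simp only [hc, h1]
    rw [Finset.card_filter_add_card_filter_not]
    simp
  have hparity : ∀ i, c i % 2 = ((i : ℕ) + 1) % 2 := by
    intro i
    have h1 := neg_one_pow_card_mul_prod_pos Finset.univ (fun k => y i - x k) fun k _ => hne i k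
    have h2 := mul_pos h1 (hprod i)
    have h3 := hcompl i
    set q := (Finset.univ.filter fun k => y i - x k < 0).card
    have h4 : (-1 : ℝ) ^ (q + (N - 1 - (i : ℕ))) < 0 := by
      rw [pow_add]
      by_contra! h5
      nlinarith [mul_nonneg h5 (sq_nonneg (∏ k, (y i - x k)))]
    have h6 : Odd (q + (N - 1 - (i : ℕ))) := by
      rcases Nat.even_or_odd (q + (N - 1 - (i : ℕ))) with h | h
      · rw [h.neg_one_pow] at h4; norm_num at h4
      · exact h
    have h7 := Nat.odd_iff.mp h6
    have := i.2
    omega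
  have hmono : ∀ i j, i ≤ j → c i ≤ c j := by
    intro i j hij
    refine Finset.card_le_card fun k hk => ?_
    simp only [Finset.mem_filter, Finset.mem_univ, true_and] at hk ⊢
    exact hk.trans_le (hy.monotone hij)
  have hlow : ∀ n (hn : n < N), n + 1 ≤ c ⟨n, hn⟩ := by
    intro n
    induction n with
    | zero => intro hn; have := hparity ⟨0, hn⟩; simp only at this; omega
    | succ n ih =>
      intro hn
      have h1 := ih (by omega)
      have h2 := hmono ⟨n, by omega⟩ ⟨n + 1, hn⟩ (by simp)
      have h3 := hparity ⟨n + 1, hn⟩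
      simp only at h3; omega
  have hup : ∀ m n (hn : n < N), m + n + 1 = N → c ⟨n, hn⟩ ≤ n + 1 := by
    intro m
    induction m with
    | zero =>
      intro n hn h
      have := hparity ⟨n, hn⟩
      have h2 := hcompl ⟨n, hn⟩
      simp only at this; omega
    | succ m ih =>
      intro n hn h
      have h1 := ih (n + 1) (by omega) (by omega)
      have h2 := hmono ⟨n, hn⟩ ⟨n + 1, by omega⟩ (by simp)
      have h3 := hparity ⟨n, hn⟩
      simp only at h3; omega
  have hcard : ∀ i : Fin N, c i = (i : ℕ) + 1 := fun i =>
    le_antisymm (hup (N - 1 - i) i i.2 (by have := i.2; omega)) (hlow i i.2)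
  intro i
  constructor
  · by_contra! h
    have : c i ≤ (Finset.Iio i.castSucc).card := by
      refine Finset.card_le_card fun k hk => ?_
      simp only [Finset.mem_filter, Finset.mem_univ, true_and, Finset.mem_Iio] at hk ⊢
      by_contra! h'
      exact absurd (h.trans (hx h')) hk.not_ge
    rw [Fin.card_Iio, hcard, Fin.val_castSucc] at this
    omega
  · by_contra! h
    have h' : x i.succ < y i := lt_of_le_of_ne h fun h' => hne i i.succ (by rw [h', sub_self])
    have : (Finset.Iic i.succ).card ≤ c i := by
      refine Finset.card_le_card fun k hk => ?_
      simp only [Finset.mem_filter, Finset.mem_univ, true_and, Finset.mem_Iic] at hk ⊢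
      exact (hx hk).trans_lt h'
    rw [Fin.card_Iic, hcard, Fin.val_succ] at this
    omega

theorem eq_of_borderParams_eq {y : Fin N → ℝ} (hy : Function.Injective y)
    {x x' : Fin (N + 1) → ℝ} (hx : Monotone x) (hx' : Monotone x')
    (h : borderParams y x = borderParams y x') : x = x' := by
  refine eq_of_monotone_of_prod_X_sub_C_eq hx hx' ?_
  have h1 := arrowPoly_borderParams hy x
  rw [h, arrowPoly_borderParams hy x'] at h1
  have h2 := congrArg (Polynomial.map Complex.ofRealHom) h1
  simpa [Polynomial.map_prod] using h2.symm

end Interlacing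

section Jacobian

variable {N : ℕ}

/-- The Jacobian matrix of `borderParams y`. -/
noncomputable def borderJacobian (y : Fin N → ℝ) (x : Fin (N + 1) → ℝ) :
    Matrix (Fin (N + 1)) (Fin (N + 1)) ℝ :=
  Matrix.of (Fin.cons (fun _ => 1) fun i k =>
    (∏ l ∈ Finset.univ.erase k, (y i - x l)) / ∏ j ∈ Finset.univ.erase i, (y i - y j))

theorem hasFDerivAt_borderParams (y : Fin N → ℝ) (x : Fin (N + 1) → ℝ) :
    HasFDerivAt (borderParams y) (borderJacobian y x).toLin'.toContinuousLinearMap x := by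
  rw [hasFDerivAt_pi']
  intro i
  refine Fin.cases ?_ (fun i => ?_) i
  · have h : HasFDerivAt (fun x : Fin (N + 1) → ℝ => ∑ k, x k - ∑ i, y i)
        (∑ k : Fin (N + 1), ContinuousLinearMap.proj (R := ℝ) (φ := fun _ => ℝ) k) x :=
      (HasFDerivAt.fun_sum fun k _ => hasFDerivAt_apply k x).sub_const _
    refine h.congr_fderiv ?_
    ext w
    simp [borderJacobian, Matrix.mulVec, dotProduct]
  · have h1 := HasFDerivAt.finsetProd (u := Finset.univ) (x := x)
      (g := fun (k : Fin (N + 1)) (x : Fin (N + 1) → ℝ) => y i - x k)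
      (g' := fun k => -ContinuousLinearMap.proj (R := ℝ) (φ := fun _ => ℝ) k)
      fun k _ => (hasFDerivAt_apply k x).const_sub (y i)
    have h2 := (h1.neg.mul_const (∏ j ∈ Finset.univ.erase i, (y i - y j))⁻¹)
    have hfun : (fun x : Fin (N + 1) → ℝ => borderParams y x i.succ) =
        fun x => -(∏ k, (y i - x k)) * (∏ j ∈ Finset.univ.erase i, (y i - y j))⁻¹ := by
      funext x; rw [borderParams, Fin.cons_succ, div_eq_mul_inv]
    rw [hfun]
    refine h2.congr_fderiv ?_
    ext w
    simp [borderJacobian, Matrix.mulVec, dotProduct, Finset.mul_sum, div_eq_mul_inv]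
    refine Finset.sum_congr rfl fun k _ => ?_
    ring

/-- The coefficients of the Lagrange polynomials `∏_{l ≠ k} (X - xₗ)`. -/
noncomputable def lagrangeCoeff {n : ℕ} (x : Fin n → ℝ) : Matrix (Fin n) (Fin n) ℝ :=
  Matrix.of fun k m =>
    (∏ l ∈ Finset.univ.erase k, (Polynomial.X - Polynomial.C (x l))).coeff m

theorem natDegree_prod_erase {n : ℕ} (x : Fin (n + 1) → ℝ) (k : Fin (n + 1)) :
    (∏ l ∈ Finset.univ.erase k, (Polynomial.X - Polynomial.C (x l))).natDegree = n := by
  rw [Polynomial.natDegree_prod_of_monic _ _ fun l _ => Polynomial.monic_X_sub_C (x l)]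
  simp

theorem sum_lagrangeCoeff_mul_pow {n : ℕ} (x : Fin (n + 1) → ℝ) (k : Fin (n + 1)) (t : ℝ) :
    ∑ m : Fin (n + 1), lagrangeCoeff x k m * t ^ (m : ℕ) =
      ∏ l ∈ Finset.univ.erase k, (t - x l) := by
  have h := Polynomial.eval_eq_sum_range' (p := ∏ l ∈ Finset.univ.erase k,
    (Polynomial.X - Polynomial.C (x l))) (n := n + 1)
    (by rw [natDegree_prod_erase]; exact Nat.lt_succ_self n) t
  refine (Fin.sum_univ_eq_sum_range (fun m => (∏ l ∈ Finset.univ.erase k,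
    (Polynomial.X - Polynomial.C (x l))).coeff m * t ^ m) (n + 1)).trans (h.symm.trans ?_)
  rw [Polynomial.eval_prod]
  simp

theorem abs_prod_prod_erase_sub {n : ℕ} (x : Fin n → ℝ) :
    |∏ k, ∏ l ∈ Finset.univ.erase k, (x k - x l)| = vandermondeDelta x ^ 2 := by
  have h : ∏ k, ∏ l ∈ Finset.univ.erase k, |x k - x l| = |vandermondeDelta x| * |vandermondeDelta x| := by
    have h1 := Finset.prod_prod_Ioi_mul_eq_prod_prod_off_diag (fun l k : Fin n => |x k - x l|)
    simp only [Finset.compl_singleton] at h1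
    rw [← h1, vandermondeDelta, Matrix.det_vandermonde, Finset.abs_prod, ← Finset.prod_mul_distrib]
    simp only [Finset.abs_prod, ← Finset.prod_mul_distrib]
    refine Finset.prod_congr rfl fun i _ => Finset.prod_congr rfl fun j _ => ?_
    rw [abs_sub_comm (x i) (x j)]
  rw [Finset.abs_prod]
  simp only [Finset.abs_prod]
  rw [h, ← abs_mul, ← pow_two, abs_sq]

theorem abs_det_lagrangeCoeff {n : ℕ} {x : Fin (n + 1) → ℝ} (hx : vandermondeDelta x ≠ 0) :
    |(lagrangeCoeff x).det| = |vandermondeDelta x| := by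
  have h : lagrangeCoeff x * (Matrix.vandermonde x)ᵀ =
      Matrix.diagonal fun k => ∏ l ∈ Finset.univ.erase k, (x k - x l) := by
    ext k i
    rw [Matrix.mul_apply]
    simp only [Matrix.transpose_apply, Matrix.vandermonde_apply]
    rw [sum_lagrangeCoeff_mul_pow, Matrix.diagonal_apply]
    split_ifs with hki
    · rw [hki]
    · exact Finset.prod_eq_zero (Finset.mem_erase.mpr ⟨fun h => hki h.symm, Finset.mem_univ i⟩)
        (sub_self _)
  have h2 := congrArg (fun M => |Matrix.det M|) h
  simp only [Matrix.det_mul, Matrix.det_transpose, Matrix.det_diagonal, abs_mul,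
    abs_prod_prod_erase_sub] at h2
  rw [← sq_abs, pow_two] at h2
  exact mul_right_cancel₀ (abs_ne_zero.mpr hx) h2

theorem vandermondeDelta_pos {n : ℕ} {x : Fin n → ℝ} (hx : StrictMono x) :
    0 < vandermondeDelta x := by
  rw [vandermondeDelta, Matrix.det_vandermonde]
  exact Finset.prod_pos fun i _ => Finset.prod_pos fun j hj =>
    sub_pos.mpr (hx (Finset.mem_Ioi.mp hj))

/-- The Jacobian determinant of `borderParams`. The Jacobian matrix evaluates the Lagrange
polynomials of `x` at the points `yᵢ` and at infinity, so that it is the product of a projective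
Vandermonde matrix and of `lagrangeCoeff x`. -/
theorem abs_det_borderJacobian {y : Fin N → ℝ} (hy : StrictMono y) {x : Fin (N + 1) → ℝ}
    (hx : StrictMono x) :
    |(borderJacobian y x).det| = vandermondeDelta x / vandermondeDelta y := by
  set v : Fin (N + 1) → ℝ := Fin.cons 1 y
  set w : Fin (N + 1) → ℝ := Fin.cons 0 1
  set D : Fin N → ℝ := fun i => ∏ j ∈ Finset.univ.erase i, (y i - y j)
  have hfac : borderJacobian y x = Matrix.diagonal (Fin.cons 1 fun i => (D i)⁻¹) *
      (Matrix.projVandermonde v w * (lagrangeCoeff x)ᵀ) := by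
    ext i k
    rw [Matrix.diagonal_mul, Matrix.mul_apply]
    simp only [Matrix.projVandermonde_apply, Matrix.transpose_apply]
    refine Fin.cases ?_ (fun i => ?_) i
    · rw [Finset.sum_eq_single (Fin.last N)]
      · have h := Polynomial.monic_prod_of_monic (Finset.univ.erase k) _
          fun l _ => Polynomial.monic_X_sub_C (x l)
        rw [Polynomial.Monic, Polynomial.leadingCoeff, natDegree_prod_erase] at h
        simp [borderJacobian, v, w, lagrangeCoeff, h]
      · intro m _ hm
        have : (m.rev : ℕ) ≠ 0 := by
          have := Fin.val_lt_last hm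
          rw [Fin.val_rev]
          omega
        rw [show w 0 = 0 from rfl, zero_pow this, mul_zero, zero_mul]
      · simp
    · simp only [v, w, Fin.cons_succ, Pi.one_apply, one_pow, mul_one]
      simp only [mul_comm (y i ^ _), sum_lagrangeCoeff_mul_pow]
      simp [borderJacobian, D, div_eq_inv_mul]
  have hdetV : |(Matrix.projVandermonde v w).det| = vandermondeDelta y := by
    rw [Matrix.det_projVandermonde, Fin.prod_univ_succ, abs_mul, Fin.prod_Ioi_zero]
    simp only [Fin.prod_Ioi_succ, v, w, Fin.cons_zero, Fin.cons_succ, Pi.one_apply, mul_one,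
      mul_zero, zero_sub]
    rw [← Matrix.det_vandermonde]
    rw [Finset.abs_prod]
    simp only [abs_neg, abs_one, Finset.prod_const_one, one_mul]
    exact abs_of_pos (vandermondeDelta_pos hy)
  have hy0 := vandermondeDelta_pos hy
  have hx0 := vandermondeDelta_pos hx
  rw [hfac, Matrix.det_mul, Matrix.det_mul, Matrix.det_diagonal, Matrix.det_transpose, abs_mul,
    abs_mul, hdetV, abs_det_lagrangeCoeff hx0.ne', abs_of_pos hx0, Fin.prod_univ_succ]
  simp only [Fin.cons_zero, Fin.cons_succ, one_mul]
  rw [Finset.prod_inv_distrib, abs_inv, abs_prod_prod_erase_sub]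
  field_simp

end Jacobian

/-! ### Squared moduli of a complex vector -/

section ComplexVector

variable {N : ℕ}

theorem measurePreserving_vecMul_unitary {U : Matrix (Fin N) (Fin N) ℂ} (hU : Uᴴ * U = 1) :
    MeasurePreserving fun v : Fin N → ℂ => v ᵥ* U := by
  let f : (Fin N → ℂ) →ₗ[ℂ] (Fin N → ℂ) := Matrix.toLin' Uᵀ
  have hf : ∀ v, f.restrictScalars ℝ v = v ᵥ* U := fun v => by
    simp [f, Matrix.mulVec_transpose]
  have hdet : (f.restrictScalars ℝ).det = 1 := by
    have h1 : star U.det * U.det = 1 := by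
      rw [← Matrix.det_conjTranspose, ← Matrix.det_mul, hU, Matrix.det_one]
    rw [LinearMap.det_restrictScalars, LinearMap.det_toLin', Matrix.det_transpose,
      Algebra.norm_complex_apply]
    have h2 : ((Complex.normSq U.det : ℝ) : ℂ) = 1 := by
      rw [Complex.normSq_eq_conj_mul_self]; exact h1
    exact_mod_cast h2
  have hmap := Measure.map_linearMap_addHaar_eq_smul_addHaar
    (volume : Measure (Fin N → ℂ)) (f := f.restrictScalars ℝ) (by rw [hdet]; exact one_ne_zero)
  rw [hdet] at hmap
  have hfun : (fun v : Fin N → ℂ => v ᵥ* U) = f.restrictScalars ℝ := (funext hf).symm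
  rw [hfun]
  refine ⟨(LinearMap.continuous_of_finiteDimensional _).measurable, ?_⟩
  rw [hmap]; simp

theorem map_norm_sq_volume :
    Measure.map (fun z : ℂ => ‖z‖ ^ 2) volume =
      ENNReal.ofReal Real.pi • (volume : Measure ℝ).restrict (Set.Ioi 0) := by
  have hm : Measurable fun z : ℂ => ‖z‖ ^ 2 := by fun_prop
  refine Measure.ext_of_lintegral _ fun g hg => ?_
  rw [lintegral_map hg hm, ← Complex.lintegral_comp_polarCoord_symm, lintegral_smul_measure]
  have himg : (fun r : ℝ => r ^ 2) '' Set.Ioi 0 = Set.Ioi 0 := by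
    ext s
    constructor
    · rintro ⟨r, hr, rfl⟩
      exact pow_pos (Set.mem_Ioi.mp hr) 2
    · intro hs
      exact ⟨Real.sqrt s, Real.sqrt_pos.mpr hs, Real.sq_sqrt (le_of_lt hs)⟩
  have hcov := lintegral_image_eq_lintegral_abs_deriv_mul (s := Set.Ioi (0 : ℝ))
    (f := fun r : ℝ => r ^ 2) (f' := fun r => 2 * r) measurableSet_Ioi
    (fun x _ => by simpa using (hasDerivAt_pow 2 x).hasDerivWithinAt)
    (fun a ha b hb h => (pow_left_inj₀ (le_of_lt ha) (le_of_lt hb) two_ne_zero).mp h) g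
  rw [himg] at hcov
  rw [hcov]
  have htgt : polarCoord.target = Set.Ioi (0 : ℝ) ×ˢ Set.Ioo (-Real.pi) Real.pi := rfl
  rw [htgt, Measure.volume_eq_prod, ← Measure.prod_restrict]
  have hF : ∀ p : ℝ × ℝ, ENNReal.ofReal p.1 • g (‖Complex.polarCoord.symm p‖ ^ 2)
      = ENNReal.ofReal p.1 * g (p.1 ^ 2) := fun p => by
    rw [Complex.norm_polarCoord_symm, sq_abs, smul_eq_mul]
  simp only [hF]
  rw [lintegral_prod _ (by fun_prop)]
  simp only [lintegral_const, Measure.restrict_apply MeasurableSet.univ, Set.univ_inter,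
    Real.volume_Ioo, smul_eq_mul]
  rw [← lintegral_const_mul _ (by fun_prop)]
  refine setLIntegral_congr_fun measurableSet_Ioi fun r hr => ?_
  have hr' : (0 : ℝ) < r := hr
  rw [abs_of_pos (by positivity), show Real.pi - -Real.pi = 2 * Real.pi by ring,
    ENNReal.ofReal_mul (by norm_num), ENNReal.ofReal_mul (by norm_num)]
  ring

/-- The squared moduli of the components of a complex vector are distributed according to a
multiple of Lebesgue measure on the positive orthant. -/
theorem map_norm_sq_pi_volume (N : ℕ) :
    Measure.map (fun (v : Fin N → ℂ) i => ‖v i‖ ^ 2) volume =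
      ENNReal.ofReal Real.pi ^ N •
        (volume : Measure (Fin N → ℝ)).restrict (Set.univ.pi fun _ => Set.Ioi 0) := by
  have hs : SigmaFinite (Measure.map (fun z : ℂ => ‖z‖ ^ 2) volume) := by
    rw [map_norm_sq_volume]
    exact inferInstanceAs (SigmaFinite (Real.toNNReal Real.pi • _))
  have h := Measure.pi_map_pi (μ := fun _ : Fin N => (volume : Measure ℂ))
    (f := fun _ z => ‖z‖ ^ 2) (hμ := fun _ => hs)
    fun _ => (by fun_prop : Measurable fun z : ℂ => ‖z‖ ^ 2).aemeasurable
  rw [volume_pi, h]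
  refine Measure.pi_eq fun s hs => ?_
  rw [map_norm_sq_volume, volume_pi, Measure.restrict_pi_pi, Measure.smul_apply, Measure.pi_pi]
  simp [Finset.prod_mul_distrib]

end ComplexVector

/-! ### The law of the eigenvalues of a bordered matrix -/

section Law

variable {N : ℕ}

/-- The diagonal matrix with real entries `y`. -/
noncomputable def diagonalHermitian (y : Fin N → ℝ) : HermitianMat N :=
  ⟨Matrix.diagonal fun i => (y i : ℂ), Matrix.isHermitian_diagonal_of_self_adjoint _
    (by ext i; simp)⟩

/-- The ordered eigenvalues of the arrow matrix with diagonal `a, y` and border `√r`. -/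
noncomputable def arrowEigenvalues (y : Fin N → ℝ) (a : ℝ) (r : Fin N → ℝ) : Fin (N + 1) → ℝ :=
  sortedEigenvalues (border a (fun i => (Real.sqrt (r i) : ℂ)) (diagonalHermitian y)).2

theorem continuous_arrowEigenvalues (y : Fin N → ℝ) :
    Continuous fun q : ℝ × (Fin N → ℝ) => arrowEigenvalues y q.1 q.2 :=
  (continuous_sortedEigenvalues (N + 1)).comp (continuous_border.comp
    (g := fun q : HermitianMat N × ℝ × (Fin N → ℂ) => border q.2.1 q.2.2 q.1)
    (f := fun q : ℝ × (Fin N → ℝ) =>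
      (diagonalHermitian y, q.1, fun i => (Real.sqrt (q.2 i) : ℂ))) (by fun_prop))

theorem charpoly_arrow (y : Fin N → ℝ) (a : ℝ) {r : Fin N → ℝ} (hr : ∀ i, 0 ≤ r i) :
    (border a (fun i => (Real.sqrt (r i) : ℂ)) (diagonalHermitian y)).1.charpoly =
      (arrowPoly y a r).map Complex.ofRealHom := by
  have h := charpoly_borderMatrix a (fun i => (Real.sqrt (r i) : ℂ)) y
    (U := 1) (by simp) (by simp)
  have hr' : (fun i => ‖((fun i => (Real.sqrt (r i) : ℂ)) ᵥ* (1 : Matrix (Fin N) (Fin N) ℂ)) i‖ ^ 2)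
      = r := by
    funext i
    simp [Real.sq_sqrt (hr i)]
  rw [hr'] at h
  simpa [border, diagonalHermitian] using h

/-- The eigenvalues of a bordered matrix depend only on the eigenvalues of the block and on the
moduli of the border in an eigenbasis. -/
theorem sortedEigenvalues_border (a : ℝ) (v : Fin N → ℂ) (M : HermitianMat N)
    {U : Matrix (Fin N) (Fin N) ℂ} (hU : Uᴴ * U = 1) (hU' : U * Uᴴ = 1)
    (hM : M.1 = U * Matrix.diagonal (fun i => (sortedEigenvalues M.2 i : ℂ)) * Uᴴ) :
    sortedEigenvalues (border a v M).2 =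
      arrowEigenvalues (sortedEigenvalues M.2) a fun i => ‖(v ᵥ* U) i‖ ^ 2 := by
  refine sortedEigenvalues_eq_of_charpoly _ (sortedEigenvalues_monotone _) ?_
  rw [arrowEigenvalues, ← charpoly_eq_prod_sortedEigenvalues, charpoly_arrow _ _ fun i => sq_nonneg _,
    ← charpoly_borderMatrix _ _ _ hU hU', ← hM]
  rfl

theorem arrowEigenvalues_borderParams {y : Fin N → ℝ} (hy : StrictMono y)
    {x : Fin (N + 1) → ℝ} (hx : x ∈ interlacing y) :
    arrowEigenvalues y (borderParams y x 0) (fun i => borderParams y x i.succ) = x := by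
  refine sortedEigenvalues_eq_of_charpoly _ (strictMono_of_mem_interlacing hx).monotone ?_
  rw [charpoly_arrow _ _ fun i => (borderParams_succ_pos_of_mem_interlacing hy hx i).le,
    arrowPoly_borderParams hy.injective]
  simp [Polynomial.map_prod]

theorem trace_border (a : ℝ) (v : Fin N → ℂ) (M : HermitianMat N) :
    (border a v M).1.trace = a + M.1.trace := by
  simp [border, borderMatrix, Matrix.trace, Fin.sum_univ_succ]

theorem borderParams_arrowEigenvalues {y : Fin N → ℝ} (hy : Function.Injective y)
    (a : ℝ) {r : Fin N → ℝ} (hr : ∀ i, 0 ≤ r i) :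
    borderParams y (arrowEigenvalues y a r) = Fin.cons a r := by
  have h := charpoly_eq_prod_sortedEigenvalues
    (border a (fun i => (Real.sqrt (r i) : ℂ)) (diagonalHermitian y)).2
  rw [charpoly_arrow y a hr] at h
  have h' : arrowPoly y a r = ∏ k, (Polynomial.X - Polynomial.C (arrowEigenvalues y a r k)) := by
    apply Polynomial.map_injective _ Complex.ofRealHom.injective
    rw [h]
    simp [Polynomial.map_prod, arrowEigenvalues]
  funext k
  refine Fin.cases ?_ (fun i => ?_) k
  · have htr := trace_eq_sum_sortedEigenvalues
      (border a (fun i => (Real.sqrt (r i) : ℂ)) (diagonalHermitian y)).2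
    rw [trace_border] at htr
    have h3 : (a : ℂ) + ∑ i, (y i : ℂ) = ∑ k, (arrowEigenvalues y a r k : ℂ) := by
      refine Eq.trans ?_ htr
      simp [diagonalHermitian, Matrix.trace_diagonal]
    have h2 : a + ∑ i, y i = ∑ k, arrowEigenvalues y a r k := by exact_mod_cast h3
    simp only [borderParams, Fin.cons_zero]
    linarith
  · have h2 := congrArg (Polynomial.eval (y i)) h'
    rw [eval_arrowPoly_apply, Polynomial.eval_prod] at h2
    simp only [Polynomial.eval_sub, Polynomial.eval_X, Polynomial.eval_C] at h2
    rw [borderParams, Fin.cons_succ, Fin.cons_succ, ← h2, neg_neg,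
      mul_div_cancel_right₀ _ (prod_erase_sub_ne_zero hy i)]

theorem image_borderParams_interlacing {y : Fin N → ℝ} (hy : StrictMono y) :
    borderParams y '' interlacing y = {q | ∀ i : Fin N, 0 < q i.succ} := by
  ext q
  constructor
  · rintro ⟨x, hx, rfl⟩ i
    exact borderParams_succ_pos_of_mem_interlacing hy hx i
  · intro hq
    have h := borderParams_arrowEigenvalues hy.injective (q 0) (r := fun i => q i.succ)
      fun i => (hq i).le
    have hq' : (Fin.cons (q 0) fun i => q i.succ : Fin (N + 1) → ℝ) = q := Fin.cons_self_tail q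
    rw [hq'] at h
    refine ⟨_, mem_interlacing_of_borderParams_pos hy (sortedEigenvalues_monotone _) ?_, h⟩
    intro i
    have := hq i
    rw [← h] at this
    exact this

/-- Change of variables from the parameters of an arrow matrix to its eigenvalues. -/
theorem lintegral_arrowEigenvalues {y : Fin N → ℝ} (hy : StrictMono y)
    {g : ℝ × (Fin (N + 1) → ℝ) → ENNReal} (hg : Measurable g) :
    ∫⁻ a : ℝ, ∫⁻ r in Set.univ.pi fun _ : Fin N => Set.Ioi (0 : ℝ), g (a, arrowEigenvalues y a r) =
      ∫⁻ x in interlacing y, ENNReal.ofReal (vandermondeDelta x / vandermondeDelta y) *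
        g (∑ k, x k - ∑ i, y i, x) := by
  have hmeas : Measurable fun q : ℝ × (Fin N → ℝ) => g (q.1, arrowEigenvalues y q.1 q.2) :=
    hg.comp (measurable_fst.prodMk (continuous_arrowEigenvalues y).measurable)
  have hL : ∫⁻ a : ℝ, ∫⁻ r in Set.univ.pi fun _ : Fin N => Set.Ioi (0 : ℝ),
      g (a, arrowEigenvalues y a r) =
      ∫⁻ q in {q : Fin (N + 1) → ℝ | ∀ i : Fin N, 0 < q i.succ},
        g (q 0, arrowEigenvalues y (q 0) fun i => q i.succ) := by
    have hmp := (volume_preserving_piFinSuccAbove (fun _ : Fin (N + 1) => ℝ) 0)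
    have hset : {q : Fin (N + 1) → ℝ | ∀ i : Fin N, 0 < q i.succ} =
        (MeasurableEquiv.piFinSuccAbove (fun _ : Fin (N + 1) => ℝ) 0) ⁻¹'
          (Set.univ ×ˢ Set.univ.pi fun _ : Fin N => Set.Ioi (0 : ℝ)) := by
      ext q; simp [Fin.tail]
    rw [hset]
    refine Eq.trans ?_ (hmp.setLIntegral_comp_preimage (MeasurableSet.univ.prod
      (MeasurableSet.univ_pi fun _ => measurableSet_Ioi)) hmeas).symm
    rw [Measure.volume_eq_prod, ← Measure.prod_restrict, lintegral_prod _ hmeas.aemeasurable,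
      Measure.restrict_univ]
  rw [hL, ← image_borderParams_interlacing hy, lintegral_image_eq_lintegral_abs_det_fderiv_mul volume
    (isOpen_interlacing y).measurableSet
    (fun x _ => (hasFDerivAt_borderParams y x).hasFDerivWithinAt)
    (fun x hx x' hx' h => eq_of_borderParams_eq hy.injective
      (strictMono_of_mem_interlacing hx).monotone (strictMono_of_mem_interlacing hx').monotone h)]
  refine setLIntegral_congr_fun (isOpen_interlacing y).measurableSet fun x hx => ?_
  rw [arrowEigenvalues_borderParams hy hx, ← abs_det_borderJacobian hy
    (strictMono_of_mem_interlacing hx)]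
  congr 2
  · congr 1
    rw [LinearMap.det_toContinuousLinearMap, LinearMap.det_toLin']

/-- The joint law of the corner entry and of the eigenvalues of a bordered matrix, for a block with
simple spectrum `y`: it lives on the families interlacing `y`. -/
theorem lintegral_sortedEigenvalues_border (M : HermitianMat N)
    (hM : StrictMono (sortedEigenvalues M.2))
    {g : ℝ × (Fin (N + 1) → ℝ) → ENNReal} (hg : Measurable g) :
    ∫⁻ a : ℝ, ∫⁻ v : Fin N → ℂ, g (a, sortedEigenvalues (border a v M).2) =
      ENNReal.ofReal Real.pi ^ N * ∫⁻ x in interlacing (sortedEigenvalues M.2),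
        ENNReal.ofReal (vandermondeDelta x / vandermondeDelta (sortedEigenvalues M.2)) *
          g (∑ k, x k - ∑ i, sortedEigenvalues M.2 i, x) := by
  obtain ⟨U, hU, hU', h⟩ := exists_unitary_diagonal_sortedEigenvalues M.2
  set y := sortedEigenvalues M.2 with hy
  have hmeas : Measurable fun q : ℝ × (Fin N → ℝ) => g (q.1, arrowEigenvalues y q.1 q.2) :=
    hg.comp (measurable_fst.prodMk (continuous_arrowEigenvalues y).measurable)
  have hsq : Measurable fun (v : Fin N → ℂ) i => ‖v i‖ ^ 2 := by fun_prop
  have hin : ∀ a : ℝ, ∫⁻ v : Fin N → ℂ, g (a, sortedEigenvalues (border a v M).2) =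
      ENNReal.ofReal Real.pi ^ N * ∫⁻ r in Set.univ.pi fun _ : Fin N => Set.Ioi (0 : ℝ),
        g (a, arrowEigenvalues y a r) := by
    intro a
    have hga : Measurable fun r => g (a, arrowEigenvalues y a r) :=
      hmeas.comp measurable_prodMk_left
    have e1 : ∀ v : Fin N → ℂ, g (a, sortedEigenvalues (border a v M).2) =
        g (a, arrowEigenvalues y a fun i => ‖(v ᵥ* U) i‖ ^ 2) := fun v => by
      rw [sortedEigenvalues_border a v M hU hU' h]
    rw [lintegral_congr e1]
    have e2 := (measurePreserving_vecMul_unitary hU).lintegral_comp (hga.comp hsq)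
    simp only [Function.comp_apply] at e2
    rw [e2, ← lintegral_map hga hsq, map_norm_sq_pi_volume, lintegral_smul_measure, smul_eq_mul]
  rw [lintegral_congr hin, lintegral_const_mul' _ _ (by simp), lintegral_arrowEigenvalues hM hg]

end Law

/-! ### The measure on Gelfand–Tsetlin patterns -/

section Patterns

variable {N : ℕ}

/-- The pair formed by the weight of the extended pattern and its new top row `x`, for a pattern of
weight `p.1.1` and top row `p.1.2`. -/
noncomputable def extendPattern (N : ℕ) (p : ((Fin N → ℝ) × (Fin N → ℝ)) × (Fin (N + 1) → ℝ)) :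
    (Fin (N + 1) → ℝ) × (Fin (N + 1) → ℝ) :=
  (Fin.cons (∑ k, p.2 k - ∑ i, p.1.2 i) p.1.1, p.2)

/-- The pairs (pattern, row) such that the row interlaces the top row of the pattern. -/
def interlacingPairs (N : ℕ) : Set (((Fin N → ℝ) × (Fin N → ℝ)) × (Fin (N + 1) → ℝ)) :=
  {p | p.2 ∈ interlacing p.1.2}

/-- The image of Lebesgue measure on Gelfand–Tsetlin patterns with `N` rows (arrays of real
numbers in which consecutive rows interlace) under the map recording the weight of the pattern,
that is the differences between the sums of consecutive rows, and its top row. -/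
noncomputable def patternMeasure : (N : ℕ) → Measure ((Fin N → ℝ) × (Fin N → ℝ))
  | 0 => Measure.dirac default
  | N + 1 => (((patternMeasure N).prod volume).restrict (interlacingPairs N)).map (extendPattern N)

instance (N : ℕ) : SFinite (patternMeasure N) := by
  induction N with
  | zero => exact inferInstanceAs (SFinite (Measure.dirac _))
  | succ N ih => unfold patternMeasure; infer_instance

theorem measurable_extendPattern (N : ℕ) : Measurable (extendPattern N) := by
  refine Measurable.prodMk (measurable_pi_iff.mpr fun k => ?_) measurable_snd
  refine Fin.cases ?_ (fun i => ?_) k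
  · simp only [Fin.cons_zero]; fun_prop
  · simp only [Fin.cons_succ]; fun_prop

theorem measurableSet_interlacingPairs (N : ℕ) : MeasurableSet (interlacingPairs N) :=
  ((isOpen_setOf_interlacing N).preimage
    (f := fun p : ((Fin N → ℝ) × (Fin N → ℝ)) × (Fin (N + 1) → ℝ) => (p.1.2, p.2))
    (by fun_prop)).measurableSet

theorem lintegral_patternMeasure_succ {f : (Fin (N + 1) → ℝ) × (Fin (N + 1) → ℝ) → ENNReal}
    (hf : Measurable f) :
    ∫⁻ p, f p ∂patternMeasure (N + 1) = ∫⁻ p, (∫⁻ x in interlacing p.2,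
      f (extendPattern N (p, x))) ∂patternMeasure N := by
  have hm : Measurable ((interlacingPairs N).indicator fun q => f (extendPattern N q)) :=
    (hf.comp (measurable_extendPattern N)).indicator (measurableSet_interlacingPairs N)
  rw [patternMeasure, lintegral_map hf (measurable_extendPattern N),
    ← lintegral_indicator (measurableSet_interlacingPairs N), lintegral_prod _ hm.aemeasurable]
  refine lintegral_congr fun p => ?_
  rw [← lintegral_indicator (isOpen_interlacing p.2).measurableSet]
  rfl

theorem isOpen_setOf_strictMono (N : ℕ) : IsOpen {x : Fin N → ℝ | StrictMono x} := by
  have : {x : Fin N → ℝ | StrictMono x} = ⋂ i : Fin N, ⋂ j : Set.Ioi i, {x | x i < x j} := by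
    ext x; simp [StrictMono]
  rw [this]
  exact isOpen_iInter_of_finite fun i => isOpen_iInter_of_finite fun j =>
    isOpen_lt (continuous_apply i) (continuous_apply j.1)

theorem ae_strictMono_patternMeasure (N : ℕ) : ∀ᵐ p ∂patternMeasure N, StrictMono p.2 := by
  cases N with
  | zero => exact Filter.Eventually.of_forall fun p i => i.elim0
  | succ N =>
    have hS : MeasurableSet {p : (Fin (N + 1) → ℝ) × (Fin (N + 1) → ℝ) | StrictMono p.2} :=
      (isOpen_setOf_strictMono (N + 1)).measurableSet.preimage measurable_snd
    rw [patternMeasure, ae_map_iff (measurable_extendPattern N).aemeasurable hS,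
      ae_restrict_iff' (measurableSet_interlacingPairs N)]
    exact Filter.Eventually.of_forall fun p hp => strictMono_of_mem_interlacing hp

/-- The (real) diagonal of a Hermitian matrix. -/
noncomputable def realDiag (M : HermitianMat N) : Fin N → ℝ := fun i => (M.1 i i).re

theorem continuous_realDiag (N : ℕ) : Continuous (realDiag (N := N)) :=
  continuous_pi fun i => Complex.continuous_re.comp (continuous_subtype_val.matrix_elem i i)

theorem realDiag_border (a : ℝ) (v : Fin N → ℂ) (M : HermitianMat N) :
    realDiag (border a v M) = Fin.cons a (realDiag M) := by
  funext k
  refine Fin.cases ?_ (fun i => ?_) k <;> simp [realDiag, border, borderMatrix]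

theorem measurable_vandermondeDelta (N : ℕ) :
    Measurable fun x : Fin N → ℝ => vandermondeDelta x := by
  simp only [vandermondeDelta, Matrix.det_vandermonde]
  fun_prop

/-- The joint law of the diagonal and of the ordered eigenvalues of a Hermitian matrix: Lebesgue
measure on Hermitian matrices disintegrates over Gelfand–Tsetlin patterns, the rows being the
ordered spectra of the successive lower right blocks. -/
theorem lintegral_realDiag_sortedEigenvalues (N : ℕ) :
    ∀ {f : (Fin N → ℝ) × (Fin N → ℝ) → ENNReal}, Measurable f →
    ∫⁻ M, f (realDiag M, sortedEigenvalues M.2) ∂hermitianVolume N =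
      ENNReal.ofReal Real.pi ^ (N * (N - 1) / 2) *
        ∫⁻ p, ENNReal.ofReal (vandermondeDelta p.2) * f p ∂patternMeasure N := by
  induction N with
  | zero =>
    intro f hf
    have h1 : ∀ M : HermitianMat 0, f (realDiag M, sortedEigenvalues M.2) = f default := fun M =>
      congrArg f (Subsingleton.elim _ _)
    have h2 : hermitianVolume 0 Set.univ = 1 := by
      rw [hermitianVolume, Measure.map_apply (measurable_hermitianOfCoords 0) MeasurableSet.univ,
        Set.preimage_univ, Measure.volume_eq_prod, ← Set.univ_prod_univ, Measure.prod_prod,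
        volume_pi, volume_pi, Measure.pi_univ, Measure.pi_univ]
      have : IsEmpty {p : Fin 0 × Fin 0 // p.1 < p.2} := ⟨fun p => p.1.1.elim0⟩
      simp
    simp only [h1, lintegral_const, h2, mul_one, patternMeasure, vandermondeDelta, Matrix.det_fin_zero]
    rw [lintegral_dirac]
    simp
  | succ N ih =>
    intro f hf
    have hE := (continuous_sortedEigenvalues N).measurable
    have hE' := (continuous_sortedEigenvalues (N + 1)).measurable
    have hD' := (continuous_realDiag (N + 1)).measurable
    -- the induction hypothesis, for the indicator function of the degenerate spectra
    have hstrict : ∀ᵐ M ∂hermitianVolume N, StrictMono (sortedEigenvalues M.2) := by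
      have hS : MeasurableSet {p : (Fin N → ℝ) × (Fin N → ℝ) | ¬ StrictMono p.2} :=
        ((isOpen_setOf_strictMono N).measurableSet.preimage measurable_snd).compl
      have h1 := ih (f := Set.indicator {p | ¬ StrictMono p.2} 1) (measurable_one.indicator hS)
      have h2 : ∫⁻ p, ENNReal.ofReal (vandermondeDelta p.2) *
          Set.indicator {p : (Fin N → ℝ) × (Fin N → ℝ) | ¬ StrictMono p.2} 1 p
            ∂patternMeasure N = 0 := by
        rw [← lintegral_zero (μ := patternMeasure N)]
        refine lintegral_congr_ae ?_
        filter_upwards [ae_strictMono_patternMeasure N] with p hp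
        rw [Set.indicator_of_notMem (by simpa using hp), mul_zero]
      rw [h2, mul_zero] at h1
      have h3 : MeasurableSet {M : HermitianMat N | ¬ StrictMono (sortedEigenvalues M.2)} :=
        ((isOpen_setOf_strictMono N).measurableSet.preimage hE).compl
      rw [ae_iff, ← lintegral_indicator_one h3]
      exact h1
    have hsucc := lintegral_hermitianVolume_succ (hf.comp (hD'.prodMk hE'))
    simp only [Function.comp_apply] at hsucc
    rw [hsucc]
    set F : ((Fin N → ℝ) × (Fin N → ℝ)) × (Fin (N + 1) → ℝ) → ENNReal := fun q =>
      (interlacingPairs N).indicator (fun q => ENNReal.ofReal (vandermondeDelta q.2 /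
        vandermondeDelta q.1.2) * f (extendPattern N q)) q with hF
    have hFm : Measurable F := by
      refine Measurable.indicator ?_ (measurableSet_interlacingPairs N)
      refine Measurable.mul (ENNReal.measurable_ofReal.comp ?_)
        (hf.comp (measurable_extendPattern N))
      exact ((measurable_vandermondeDelta _).comp measurable_snd).div
        ((measurable_vandermondeDelta _).comp (measurable_snd.comp measurable_fst))
    have hFx : ∀ p : (Fin N → ℝ) × (Fin N → ℝ), ∫⁻ x, F (p, x) =
        ∫⁻ x in interlacing p.2, ENNReal.ofReal (vandermondeDelta x / vandermondeDelta p.2) *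
          f (extendPattern N (p, x)) := fun p => by
      rw [← lintegral_indicator (isOpen_interlacing p.2).measurableSet]
      rfl
    -- the inner integral is a function of the diagonal and the spectrum of the block
    have hstep : ∀ᵐ M ∂hermitianVolume N,
        ∫⁻ a : ℝ, ∫⁻ v : Fin N → ℂ, f (realDiag (border a v M), sortedEigenvalues (border a v M).2)
        = ENNReal.ofReal Real.pi ^ N * ∫⁻ x, F ((realDiag M, sortedEigenvalues M.2), x) := by
      filter_upwards [hstrict] with M hM
      have hg : Measurable fun q : ℝ × (Fin (N + 1) → ℝ) =>
          f (Fin.cons q.1 (realDiag M), q.2) := by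
        refine hf.comp (Measurable.prodMk (measurable_pi_iff.mpr fun k => ?_) measurable_snd)
        refine Fin.cases ?_ (fun i => ?_) k
        · simp only [Fin.cons_zero]; fun_prop
        · simp only [Fin.cons_succ]; fun_prop
      simp only [realDiag_border]
      rw [hFx]
      exact lintegral_sortedEigenvalues_border M hM hg
    rw [lintegral_congr_ae hstep, ih (f := fun p => ENNReal.ofReal Real.pi ^ N * ∫⁻ x, F (p, x))
      (hFm.lintegral_prod_right'.const_mul _)]
    have hm1 : Measurable fun p : (Fin (N + 1) → ℝ) × (Fin (N + 1) → ℝ) =>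
        ENNReal.ofReal (vandermondeDelta p.2) * f p :=
      (ENNReal.measurable_ofReal.comp ((measurable_vandermondeDelta _).comp measurable_snd)).mul hf
    rw [lintegral_patternMeasure_succ hm1, Nat.triangle_succ, pow_add, mul_assoc,
      ← lintegral_const_mul' (ENNReal.ofReal Real.pi ^ N) _ (by simp)]
    congr 1
    refine lintegral_congr_ae ?_
    filter_upwards [ae_strictMono_patternMeasure N] with p hp
    rw [hFx, mul_left_comm, ← lintegral_const_mul' _ _ ENNReal.ofReal_ne_top]
    congr 1
    refine lintegral_congr fun x => ?_
    have hy := vandermondeDelta_pos hp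
    rw [← mul_assoc, ← ENNReal.ofReal_mul hy.le, mul_div_cancel₀ _ hy.ne']
    rfl

end Patterns

/-! ### Determinantal integrals -/

section DetIntegral

variable {n : ℕ}

theorem integrable_prod_perm {n : ℕ} {μ : Fin n → Measure ℝ} [∀ j, SigmaFinite (μ j)]
    {f : Fin n → Fin n → ℝ → ℂ} (hf : ∀ i j, Integrable (f i j) (μ j)) (σ : Equiv.Perm (Fin n)) :
    Integrable (fun y : Fin n → ℝ => ∏ j, f (σ j) j (y j)) (Measure.pi μ) :=
  Integrable.fintype_prod fun j => hf (σ j) j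

theorem integrable_det_pi {μ : Fin n → Measure ℝ} [∀ j, SigmaFinite (μ j)]
    {f : Fin n → Fin n → ℝ → ℂ} (hf : ∀ i j, Integrable (f i j) (μ j)) :
    Integrable (fun y : Fin n → ℝ => (Matrix.of fun i j => f i j (y j)).det) (Measure.pi μ) := by
  simp only [Matrix.det_apply', Matrix.of_apply]
  exact integrable_finsetSum _ fun σ _ => (integrable_prod_perm hf σ).const_mul _

/-- A determinant whose columns depend on different variables is integrated entrywise. -/
theorem integral_det_pi {μ : Fin n → Measure ℝ} [∀ j, SigmaFinite (μ j)]
    {f : Fin n → Fin n → ℝ → ℂ} (hf : ∀ i j, Integrable (f i j) (μ j)) :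
    ∫ y, (Matrix.of fun i j => f i j (y j)).det ∂Measure.pi μ =
      (Matrix.of fun i j => ∫ t, f i j t ∂μ j).det := by
  simp only [Matrix.det_apply', Matrix.of_apply]
  rw [integral_finsetSum _ fun σ _ => (integrable_prod_perm hf σ).const_mul _]
  refine Finset.sum_congr rfl fun σ _ => ?_
  rw [integral_const_mul, integral_fintype_prod_eq_prod]

/-- The rows `y` interlaced by `x` form a box. -/
theorem setOf_mem_interlacing (x : Fin (n + 1) → ℝ) :
    {y : Fin n → ℝ | x ∈ interlacing y} =
      Set.univ.pi fun j : Fin n => Set.Ioo (x j.castSucc) (x j.succ) := by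
  ext y; simp [interlacing]

/-- The exponential matrix `exp (zᵢ xⱼ)`. -/
noncomputable def expMatrix (z : Fin n → ℂ) (x : Fin n → ℝ) : Matrix (Fin n) (Fin n) ℂ :=
  Matrix.of fun i j => Complex.exp (z i * x j)

theorem det_expMatrix_mul_exp (z : Fin n → ℂ) (c : ℂ) (x : Fin n → ℝ) :
    (expMatrix z x).det = Complex.exp (c * ∑ j, (x j : ℂ)) *
      (expMatrix (fun i => z i - c) x).det := by
  have h : expMatrix z x = Matrix.of fun i j =>
      (fun j => Complex.exp (c * x j)) j * expMatrix (fun i => z i - c) x i j := by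
    ext i j
    simp only [expMatrix, Matrix.of_apply, ← Complex.exp_add]
    congr 1; ring
  rw [h, Matrix.det_mul_row, ← Complex.exp_sum, Finset.mul_sum]

/-- Subtracting each column of `expMatrix (z - z₀) x` from the next one. -/
theorem det_expMatrix_sub_zero (w : Fin n → ℂ) (x : Fin (n + 1) → ℝ) :
    (expMatrix (Fin.cons 0 w) x).det =
      (Matrix.of fun i j : Fin n => Complex.exp (w i * x j.succ) -
        Complex.exp (w i * x j.castSucc)).det := by
  set A := expMatrix (Fin.cons 0 w : Fin (n + 1) → ℂ) x
  set B : Matrix (Fin (n + 1)) (Fin (n + 1)) ℂ := Matrix.of fun i =>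
    Fin.cons (A i 0) fun j => A i j.succ - A i j.castSucc
  have hAB : A.det = B.det := by
    refine Matrix.det_eq_of_forall_col_eq_smul_add_pred (fun _ => 1) (fun i => ?_) fun i j => ?_
    · simp [B]
    · simp [B]
  rw [hAB, Matrix.det_succ_row_zero, Finset.sum_eq_single 0]
  · simp only [Fin.val_zero, pow_zero, one_mul, Fin.succAbove_zero]
    have : B 0 0 = 1 := by simp [B, A, expMatrix]
    rw [this, one_mul]
    rfl
  · intro j _ hj
    obtain ⟨k, rfl⟩ := Fin.exists_succ_eq.mpr hj
    have : B 0 k.succ = 0 := by simp [B, A, expMatrix]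
    rw [this]; ring
  · simp

/-- Integrating `det (exp (z_{i+1} yⱼ))` over the rows interlaced by `x` gives the determinant of
the next size. -/
theorem integral_interlacing_det_expMatrix {z : Fin (n + 1) → ℂ} (hz : Function.Injective z)
    {x : Fin (n + 1) → ℝ} (hx : StrictMono x) :
    ∫ y in {y : Fin n → ℝ | x ∈ interlacing y},
      Complex.exp (z 0 * (∑ k, (x k : ℂ) - ∑ i, (y i : ℂ))) *
        (expMatrix (fun i => z i.succ) y).det =
      (expMatrix z x).det / ∏ i : Fin n, (z i.succ - z 0) := by
  set w : Fin n → ℂ := fun i => z i.succ - z 0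
  have hw : ∀ i, w i ≠ 0 := fun i => sub_ne_zero.mpr fun h => Fin.succ_ne_zero i (hz h)
  have h1 : ∀ y : Fin n → ℝ, Complex.exp (z 0 * (∑ k, (x k : ℂ) - ∑ i, (y i : ℂ))) *
        (expMatrix (fun i => z i.succ) y).det =
      Complex.exp (z 0 * ∑ k, (x k : ℂ)) * (expMatrix w y).det := by
    intro y
    rw [det_expMatrix_mul_exp _ (z 0), ← mul_assoc, ← Complex.exp_add]
    congr 2
    ring
  simp only [h1]
  rw [integral_const_mul, setOf_mem_interlacing, volume_pi, Measure.restrict_pi_pi]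
  have hint : ∀ i j : Fin n, Integrable (fun t : ℝ => Complex.exp (w i * t))
      (volume.restrict (Set.Ioo (x j.castSucc) (x j.succ))) := fun i j =>
    ((by fun_prop : Continuous fun t : ℝ => Complex.exp (w i * t)).integrableOn_Icc
      (a := x j.castSucc) (b := x j.succ)).mono_set Set.Ioo_subset_Icc_self
  have hval : ∀ i j : Fin n, ∫ t in Set.Ioo (x j.castSucc) (x j.succ), Complex.exp (w i * t) =
      (w i)⁻¹ * (Complex.exp (w i * x j.succ) - Complex.exp (w i * x j.castSucc)) := by
    intro i j
    rw [← integral_Ioc_eq_integral_Ioo, ← intervalIntegral.integral_of_le (hx (by simp)).le,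
      integral_exp_mul_complex (hw i), div_eq_inv_mul]
  have h2 := integral_det_pi (μ := fun j : Fin n =>
    volume.restrict (Set.Ioo (x j.castSucc) (x j.succ)))
    (f := fun i _ t => Complex.exp (w i * t)) hint
  simp only [hval] at h2
  rw [show (fun y => (expMatrix w y).det) =
    fun y => (Matrix.of fun i j => Complex.exp (w i * y j)).det from rfl, h2]
  have h3 := Matrix.det_mul_column (fun i => (w i)⁻¹) (Matrix.of fun i j : Fin n =>
    Complex.exp (w i * x j.succ) - Complex.exp (w i * x j.castSucc))
  simp only [Matrix.of_apply] at h3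
  rw [h3, ← det_expMatrix_sub_zero, det_expMatrix_mul_exp z (z 0) x]
  have h4 : (fun i => z i - z 0) = (Fin.cons 0 w : Fin (n + 1) → ℂ) := by
    funext i
    refine Fin.cases ?_ (fun i => ?_) i <;> simp [w]
  rw [h4, Finset.prod_inv_distrib]
  ring

end DetIntegral

/-! ### Exponential moments of the pattern measure -/

section Moments

variable {N : ℕ}

theorem measurableSet_setOf_interlacing (x : Fin (N + 1) → ℝ) :
    MeasurableSet {y : Fin N → ℝ | x ∈ interlacing y} := by
  rw [setOf_mem_interlacing]
  exact MeasurableSet.univ_pi fun _ => measurableSet_Ioo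

/-- A row interlaced by `x`, and the volume of the set of such rows, are controlled by
`∑ |xₖ|`. -/
theorem setLIntegral_interlacing_exp_le (x : Fin (N + 1) → ℝ) {c C : ℝ} (hc : 0 ≤ c) (hC : 0 ≤ C) :
    ∫⁻ y in {y : Fin N → ℝ | x ∈ interlacing y},
      ENNReal.ofReal (Real.exp (c * |∑ k, x k - ∑ i, y i| + C * ∑ i, |y i|)) ≤
      ENNReal.ofReal (Real.exp ((c * (N + 1) + C * N + 2 * N) * ∑ k, |x k|)) := by
  set S := ∑ k, |x k| with hS
  have hS0 : 0 ≤ S := Finset.sum_nonneg fun _ _ => abs_nonneg _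
  have hxS : ∀ k, |x k| ≤ S := fun k =>
    Finset.single_le_sum (f := fun k => |x k|) (fun _ _ => abs_nonneg _) (Finset.mem_univ k)
  have hbound : ∀ y ∈ {y : Fin N → ℝ | x ∈ interlacing y},
      ENNReal.ofReal (Real.exp (c * |∑ k, x k - ∑ i, y i| + C * ∑ i, |y i|)) ≤
      ENNReal.ofReal (Real.exp ((c * (N + 1) + C * N) * S)) := by
    intro y hy
    have hyS : ∀ i, |y i| ≤ S := fun i => by
      have h1 := hy i
      have h2 := abs_le.mp (hxS i.castSucc)
      have h3 := abs_le.mp (hxS i.succ)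
      exact abs_le.mpr ⟨by linarith, by linarith⟩
    have hsum : ∑ i, |y i| ≤ N * S :=
      (Finset.sum_le_sum fun i _ => hyS i).trans (by simp)
    have hdiff : |∑ k, x k - ∑ i, y i| ≤ (N + 1) * S := by
      refine (abs_sub _ _).trans ?_
      have := Finset.abs_sum_le_sum_abs x Finset.univ
      have := Finset.abs_sum_le_sum_abs y Finset.univ
      linarith
    refine ENNReal.ofReal_le_ofReal (Real.exp_le_exp.mpr ?_)
    nlinarith [mul_le_mul_of_nonneg_left hsum hC, mul_le_mul_of_nonneg_left hdiff hc]
  refine (setLIntegral_mono measurable_const hbound).trans ?_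
  rw [setLIntegral_const, setOf_mem_interlacing, Real.volume_pi_Ioo]
  -- each side of the box is at most `2 S ≤ exp (2 S)`
  have hvol : ∏ j : Fin N, ENNReal.ofReal (x j.succ - x j.castSucc) ≤
      ENNReal.ofReal (Real.exp (2 * N * S)) := by
    calc ∏ j : Fin N, ENNReal.ofReal (x j.succ - x j.castSucc)
        ≤ ∏ _j : Fin N, ENNReal.ofReal (Real.exp (2 * S)) := by
          refine Finset.prod_le_prod' fun j _ => ENNReal.ofReal_le_ofReal ?_
          have h2 := abs_le.mp (hxS j.castSucc)
          have h3 := abs_le.mp (hxS j.succ)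
          have := Real.add_one_le_exp (2 * S)
          linarith
      _ = ENNReal.ofReal (Real.exp (2 * N * S)) := by
          rw [Finset.prod_const, Finset.card_univ, Fintype.card_fin, ← ENNReal.ofReal_pow
            (Real.exp_pos _).le, ← Real.exp_nat_mul]
          congr 2; ring
  refine (mul_le_mul_right hvol _).trans ?_
  rw [← ENNReal.ofReal_mul (Real.exp_pos _).le, ← Real.exp_add]
  refine le_of_eq ?_
  congr 2; ring

/-- The weight of a pattern is controlled by its top row: exponential moments of the pattern
measure are bounded by exponential moments of Lebesgue measure on ordered families. -/
theorem exists_lintegral_patternMeasure_le (N : ℕ) : ∀ {c : ℝ}, 0 ≤ c → ∃ C : ℝ, 0 ≤ C ∧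
    ∀ h : (Fin N → ℝ) → ENNReal, Measurable h →
      ∫⁻ p, ENNReal.ofReal (Real.exp (c * ∑ i, |p.1 i|)) * h p.2 ∂patternMeasure N ≤
        ∫⁻ x in {x | StrictMono x}, ENNReal.ofReal (Real.exp (C * ∑ i, |x i|)) * h x := by
  induction N with
  | zero =>
    intro c _
    refine ⟨0, le_rfl, fun h hh => ?_⟩
    have hset : {x : Fin 0 → ℝ | StrictMono x} = Set.univ :=
      Set.eq_univ_of_forall fun x i => i.elim0
    rw [patternMeasure, lintegral_dirac, hset, Measure.restrict_univ, volume_pi,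
      Measure.pi_of_empty _ default, lintegral_dirac]
    simp only [Finset.univ_eq_empty, Finset.sum_empty]
    simp only [mul_zero, Real.exp_zero, ENNReal.ofReal_one, one_mul]
    exact le_of_eq (congrArg h (Subsingleton.elim _ _))
  | succ N ih =>
    intro c hc
    obtain ⟨C, hC, hle⟩ := ih hc
    refine ⟨c * (N + 1) + C * N + 2 * N, by positivity, fun h hh => ?_⟩
    have hexp : Measurable fun p : (Fin (N + 1) → ℝ) × (Fin (N + 1) → ℝ) =>
        ENNReal.ofReal (Real.exp (c * ∑ i, |p.1 i|)) * h p.2 :=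
      Measurable.mul (by fun_prop) (hh.comp measurable_snd)
    rw [lintegral_patternMeasure_succ hexp]
    set G : (Fin N → ℝ) × (Fin (N + 1) → ℝ) → ENNReal :=
      Set.indicator {q | q.2 ∈ interlacing q.1} fun q =>
        ENNReal.ofReal (Real.exp (c * |∑ k, q.2 k - ∑ i, q.1 i|)) * h q.2 with hG
    have hGm : Measurable G := Measurable.indicator
      (Measurable.mul (by fun_prop) (hh.comp measurable_snd)) (isOpen_setOf_interlacing N).measurableSet
    have hGy : ∀ y : Fin N → ℝ, ∫⁻ x, G (y, x) = ∫⁻ x in interlacing y,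
        ENNReal.ofReal (Real.exp (c * |∑ k, x k - ∑ i, y i|)) * h x := fun y => by
      rw [← lintegral_indicator (isOpen_interlacing y).measurableSet]; rfl
    have e1 : ∀ p : (Fin N → ℝ) × (Fin N → ℝ), ∫⁻ x in interlacing p.2,
        ENNReal.ofReal (Real.exp (c * ∑ i, |(extendPattern N (p, x)).1 i|)) *
          h (extendPattern N (p, x)).2 =
        ENNReal.ofReal (Real.exp (c * ∑ i, |p.1 i|)) * ∫⁻ x, G (p.2, x) := fun p => by
      rw [hGy, ← lintegral_const_mul' _ _ ENNReal.ofReal_ne_top]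
      refine lintegral_congr fun x => ?_
      simp only [extendPattern, Fin.sum_univ_succ (n := N)
        (fun i => |(Fin.cons (∑ k, x k - ∑ i, p.2 i) p.1 : Fin (N + 1) → ℝ) i|), Fin.cons_zero,
        Fin.cons_succ]
      rw [mul_add, Real.exp_add, ENNReal.ofReal_mul (Real.exp_pos _).le]
      ring
    rw [lintegral_congr e1]
    refine (hle (fun y => ∫⁻ x, G (y, x)) hGm.lintegral_prod_right').trans ?_
    have e2 : ∀ y : Fin N → ℝ, ENNReal.ofReal (Real.exp (C * ∑ i, |y i|)) * ∫⁻ x, G (y, x) =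
        ∫⁻ x, ENNReal.ofReal (Real.exp (C * ∑ i, |y i|)) * G (y, x) := fun y =>
      (lintegral_const_mul' _ _ ENNReal.ofReal_ne_top).symm
    have hGm' : Measurable fun q : (Fin N → ℝ) × (Fin (N + 1) → ℝ) =>
        ENNReal.ofReal (Real.exp (C * ∑ i, |q.1 i|)) * G q := Measurable.mul (by fun_prop) hGm
    rw [lintegral_congr e2, lintegral_lintegral_swap hGm'.aemeasurable, ← lintegral_indicator
      (isOpen_setOf_strictMono (N + 1)).measurableSet]
    refine lintegral_mono fun x => ?_
    have e3 : ∀ y : Fin N → ℝ, ENNReal.ofReal (Real.exp (C * ∑ i, |y i|)) * G (y, x) =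
        h x * Set.indicator {y : Fin N → ℝ | x ∈ interlacing y} (fun y => ENNReal.ofReal
          (Real.exp (c * |∑ k, x k - ∑ i, y i| + C * ∑ i, |y i|))) y := fun y => by
      by_cases hy : x ∈ interlacing y
      · rw [hG, Set.indicator_of_mem (by exact hy), Set.indicator_of_mem (by exact hy), Real.exp_add,
          ENNReal.ofReal_mul (Real.exp_pos _).le]
        ring
      · rw [hG, Set.indicator_of_notMem (by exact hy), Set.indicator_of_notMem (by exact hy)]
        simp
    simp only [e3]
    have hm3 : Measurable (Set.indicator {y : Fin N → ℝ | x ∈ interlacing y} (fun y => ENNReal.ofReal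
          (Real.exp (c * |∑ k, x k - ∑ i, y i| + C * ∑ i, |y i|)))) :=
      Measurable.indicator (by fun_prop) (measurableSet_setOf_interlacing x)
    rw [lintegral_const_mul _ hm3]
    by_cases hx : StrictMono x
    · rw [Set.indicator_of_mem (by exact hx), mul_comm]
      refine mul_le_mul_left ((setLIntegral_le_lintegral _ _).trans ?_) _
      rw [lintegral_indicator (measurableSet_setOf_interlacing x)]
      exact setLIntegral_interlacing_exp_le x hc hC
    · have h0 : {y : Fin N → ℝ | x ∈ interlacing y} = ∅ :=
        Set.eq_empty_of_forall_notMem fun y hy => hx (strictMono_of_mem_interlacing hy)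
      rw [h0]; simp

end Moments

/-! ### Fourier–Laplace transform of the pattern measure -/

section Transform

variable {N : ℕ}

theorem vandermondeDelta_succ {R : Type*} [CommRing R] (z : Fin (N + 1) → R) :
    vandermondeDelta z = (∏ i : Fin N, (z i.succ - z 0)) * vandermondeDelta fun i => z i.succ := by
  simp only [vandermondeDelta, Matrix.det_vandermonde]
  rw [Fin.prod_univ_succ, Fin.prod_Ioi_zero]
  simp only [Fin.prod_Ioi_succ]

/-- `h` has exponential moments of all orders on the set of strictly ordered families. -/
def HasExpMoments (h : (Fin N → ℝ) → ℂ) : Prop :=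
  ∀ C : ℝ, 0 ≤ C →
    ∫⁻ x in {x | StrictMono x}, ENNReal.ofReal (Real.exp (C * ∑ i, |x i|)) * ‖h x‖ₑ < ⊤

theorem norm_exp_sum_mul_le (z : Fin N → ℂ) (d : Fin N → ℝ) :
    ‖Complex.exp (∑ i, z i * d i)‖ ≤ Real.exp ((∑ i, ‖z i‖) * ∑ i, |d i|) := by
  rw [Complex.norm_exp]
  refine Real.exp_le_exp.mpr ((Complex.re_le_norm _).trans ((norm_sum_le _ _).trans ?_))
  rw [Finset.sum_mul]
  refine Finset.sum_le_sum fun i _ => ?_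
  rw [norm_mul, Complex.norm_real, Real.norm_eq_abs]
  exact mul_le_mul_of_nonneg_left
    (Finset.single_le_sum (f := fun i => |d i|) (fun _ _ => abs_nonneg _) (Finset.mem_univ i))
    (norm_nonneg _)

theorem integrable_exp_mul_patternMeasure (z : Fin N → ℂ) {h : (Fin N → ℝ) → ℂ}
    (hh : Measurable h) (hmom : HasExpMoments h) :
    Integrable (fun p : (Fin N → ℝ) × (Fin N → ℝ) => Complex.exp (∑ i, z i * p.1 i) * h p.2)
      (patternMeasure N) := by
  refine ⟨(Measurable.mul (by fun_prop) (hh.comp measurable_snd)).aestronglyMeasurable, ?_⟩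
  obtain ⟨C, hC, hle⟩ := exists_lintegral_patternMeasure_le N
    (c := ∑ i, ‖z i‖) (Finset.sum_nonneg fun _ _ => norm_nonneg _)
  refine lt_of_le_of_lt (lintegral_mono fun p => ?_) ((hle (fun x => ‖h x‖ₑ) hh.enorm).trans_lt
    (hmom C hC))
  rw [enorm_mul]
  refine mul_le_mul_left ?_ _
  rw [← ofReal_norm]
  exact ENNReal.ofReal_le_ofReal (norm_exp_sum_mul_le z p.1)

/-- The transform of the pattern measure in the weight variable: the ratio of `det (exp (zᵢ xⱼ))`
and of the Vandermonde determinant of `z`. -/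
theorem integral_exp_mul_patternMeasure (N : ℕ) : ∀ {z : Fin N → ℂ}, Function.Injective z →
    ∀ {h : (Fin N → ℝ) → ℂ}, Measurable h → HasExpMoments h →
    ∫ p, Complex.exp (∑ i, z i * p.1 i) * h p.2 ∂patternMeasure N =
      (∫ x in {x | StrictMono x}, (expMatrix z x).det * h x) / vandermondeDelta z := by
  induction N with
  | zero =>
    intro z _ h _ _
    have hset : {x : Fin 0 → ℝ | StrictMono x} = Set.univ :=
      Set.eq_univ_of_forall fun x i => i.elim0
    rw [patternMeasure, integral_dirac, hset, Measure.restrict_univ, volume_pi,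
      Measure.pi_of_empty _ default, integral_dirac, vandermondeDelta, Matrix.det_fin_zero,
      Matrix.det_fin_zero]
    simp only [Finset.univ_eq_empty, Finset.sum_empty, Complex.exp_zero, one_mul, div_one]
    exact congrArg h (Subsingleton.elim _ _)
  | succ N ih =>
    intro z hz h hh hmom
    set z' : Fin N → ℂ := fun i => z i.succ with hz'
    have hz'inj : Function.Injective z' := hz.comp (Fin.succ_injective N)
    have hint := integrable_exp_mul_patternMeasure z hh hmom
    have hmeas : AEStronglyMeasurable (fun p : (Fin (N + 1) → ℝ) × (Fin (N + 1) → ℝ) =>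
        Complex.exp (∑ i, z i * p.1 i) * h p.2) (patternMeasure (N + 1)) := hint.1
    rw [patternMeasure] at hint hmeas ⊢
    rw [integral_map (measurable_extendPattern N).aemeasurable hmeas]
    rw [integrable_map_measure hmeas (measurable_extendPattern N).aemeasurable] at hint
    rw [← integral_indicator (measurableSet_interlacingPairs N)]
    rw [← IntegrableOn, ← integrable_indicator_iff (measurableSet_interlacingPairs N)] at hint
    -- the density in the variable `y` seen by the induction hypothesis, for a given row `x`
    set k : (Fin (N + 1) → ℝ) → (Fin N → ℝ) → ℂ := fun x =>
      Set.indicator {y | x ∈ interlacing y} fun y =>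
        Complex.exp (z 0 * (∑ k, (x k : ℂ) - ∑ i, (y i : ℂ))) with hk
    have hfun : ∀ q : ((Fin N → ℝ) × (Fin N → ℝ)) × (Fin (N + 1) → ℝ),
        (interlacingPairs N).indicator (fun q => Complex.exp (∑ i, z i * (extendPattern N q).1 i) *
          h (extendPattern N q).2) q =
        h q.2 * (Complex.exp (∑ i, z' i * q.1.1 i) * k q.2 q.1.2) := by
      intro q
      by_cases hq : q.2 ∈ interlacing q.1.2
      · rw [Set.indicator_of_mem (by exact hq), hk]
        simp only
        rw [Set.indicator_of_mem (by exact hq), extendPattern, Fin.sum_univ_succ]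
        simp only [Fin.cons_zero, Fin.cons_succ]
        rw [Complex.exp_add]
        push_cast
        ring
      · rw [Set.indicator_of_notMem (by exact hq), hk]
        simp only
        rw [Set.indicator_of_notMem (by exact hq)]
        simp
    have hint' : Integrable (fun q => (interlacingPairs N).indicator (fun q =>
        Complex.exp (∑ i, z i * (extendPattern N q).1 i) * h (extendPattern N q).2) q)
        ((patternMeasure N).prod volume) := hint
    rw [integral_prod_symm _ hint']
    have hinner : ∀ x : Fin (N + 1) → ℝ, ∫ p, (interlacingPairs N).indicator
        (fun q => Complex.exp (∑ i, z i * (extendPattern N q).1 i) * h (extendPattern N q).2)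
          (p, x) ∂patternMeasure N =
        Set.indicator {x : Fin (N + 1) → ℝ | StrictMono x}
          (fun x => (expMatrix z x).det * h x / vandermondeDelta z) x := by
      intro x
      have hkm : Measurable (k x) :=
        Measurable.indicator (by fun_prop) (measurableSet_setOf_interlacing x)
      have hkmom : HasExpMoments (k x) := by
        intro C hC
        have hb := setLIntegral_interlacing_exp_le x (norm_nonneg (z 0)) hC
        refine lt_of_le_of_lt (setLIntegral_le_lintegral _ _) (lt_of_le_of_lt ?_
          (hb.trans_lt ENNReal.ofReal_lt_top))
        rw [← lintegral_indicator (measurableSet_setOf_interlacing x)]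
        refine lintegral_mono fun y => ?_
        by_cases hy : x ∈ interlacing y
        · rw [hk]
          simp only
          rw [Set.indicator_of_mem (by exact hy), Set.indicator_of_mem (by exact hy),
            ← ofReal_norm, ← ENNReal.ofReal_mul (Real.exp_pos _).le]
          refine ENNReal.ofReal_le_ofReal ?_
          rw [Real.exp_add, mul_comm]
          refine mul_le_mul_of_nonneg_right ?_ (Real.exp_pos _).le
          rw [Complex.norm_exp]
          refine Real.exp_le_exp.mpr ((Complex.re_le_norm _).trans ?_)
          rw [norm_mul, ← Real.norm_eq_abs, ← Complex.norm_real]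
          push_cast
          rfl
        · rw [hk]
          simp only
          rw [Set.indicator_of_notMem (by exact hy), enorm_zero, mul_zero]
          exact zero_le
      simp only [hfun]
      rw [integral_const_mul, ih hz'inj hkm hkmom]
      have hbox : ∫ y in {y : Fin N → ℝ | StrictMono y}, (expMatrix z' y).det * k x y =
          ∫ y in {y : Fin N → ℝ | x ∈ interlacing y},
            Complex.exp (z 0 * (∑ k, (x k : ℂ) - ∑ i, (y i : ℂ))) * (expMatrix z' y).det := by
        rw [← integral_indicator (isOpen_setOf_strictMono N).measurableSet,
          ← integral_indicator (measurableSet_setOf_interlacing x)]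
        refine integral_congr_ae (Filter.Eventually.of_forall fun y => ?_)
        by_cases hy : x ∈ interlacing y
        · have hys : StrictMono y := fun i j hij =>
            ((hy i).2.trans_le ((strictMono_of_mem_interlacing hy).monotone
              (Fin.castSucc_lt_iff_succ_le.mp hij))).trans (hy j).1
          simp only [hk]
          rw [Set.indicator_of_mem (by exact hys), Set.indicator_of_mem (by exact hy),
            Set.indicator_of_mem (by exact hy), mul_comm]
        · simp only [hk]
          rw [Set.indicator_of_notMem (s := {y : Fin N → ℝ | x ∈ interlacing y}) (by exact hy)]
          rw [Set.indicator_apply]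
          rw [Set.indicator_of_notMem (s := {y : Fin N → ℝ | x ∈ interlacing y}) (by exact hy)]
          simp
      rw [hbox]
      by_cases hx : StrictMono x
      · rw [Set.indicator_of_mem (by exact hx), integral_interlacing_det_expMatrix hz hx,
          vandermondeDelta_succ z, div_div]
        ring
      · have h0 : {y : Fin N → ℝ | x ∈ interlacing y} = ∅ :=
          Set.eq_empty_of_forall_notMem fun y hy => hx (strictMono_of_mem_interlacing hy)
        rw [Set.indicator_of_notMem (by exact hx), h0]
        simp
    simp only [hinner]
    rw [integral_indicator (isOpen_setOf_strictMono (N + 1)).measurableSet, integral_div]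

end Transform

section HermitianTransform

variable {N : ℕ}

/-- The law of `(diagonal, ordered eigenvalues)` under the flat measure. -/
theorem map_realDiag_sortedEigenvalues (N : ℕ) :
    Measure.map (fun M : HermitianMat N => (realDiag M, sortedEigenvalues M.2)) (hermitianVolume N) =
      ENNReal.ofReal Real.pi ^ (N * (N - 1) / 2) •
        (patternMeasure N).withDensity fun p => ENNReal.ofReal (vandermondeDelta p.2) := by
  have hΔ : Measurable fun p : (Fin N → ℝ) × (Fin N → ℝ) =>
      ENNReal.ofReal (vandermondeDelta p.2) :=
    ENNReal.measurable_ofReal.comp ((measurable_vandermondeDelta N).comp measurable_snd)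
  refine Measure.ext_of_lintegral _ fun f hf => ?_
  rw [lintegral_map hf ((continuous_realDiag N).measurable.prodMk
    (continuous_sortedEigenvalues N).measurable), lintegral_realDiag_sortedEigenvalues N hf,
    lintegral_smul_measure, lintegral_withDensity_eq_lintegral_mul _ hΔ hf]
  rfl

/-- Radial reduction of the Fourier–Laplace transform of a function of the spectrum of a Hermitian
matrix, evaluated on diagonal matrices. -/
theorem integral_exp_mul_sortedEigenvalues {z : Fin N → ℂ} (hz : Function.Injective z)
    {F : (Fin N → ℝ) → ℂ} (hF : Measurable F)
    (hmom : HasExpMoments fun x => ((vandermondeDelta x : ℝ) : ℂ) * F x) :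
    Integrable (fun M : HermitianMat N =>
      Complex.exp (∑ i, z i * realDiag M i) * F (sortedEigenvalues M.2)) (hermitianVolume N) ∧
    ∫ M, Complex.exp (∑ i, z i * realDiag M i) * F (sortedEigenvalues M.2) ∂hermitianVolume N =
      (Real.pi : ℂ) ^ (N * (N - 1) / 2) * ((∫ x in {x | StrictMono x},
        (expMatrix z x).det * (((vandermondeDelta x : ℝ) : ℂ) * F x)) / vandermondeDelta z) := by
  set Φ : (Fin N → ℝ) × (Fin N → ℝ) → ℂ := fun p => Complex.exp (∑ i, z i * p.1 i) * F p.2 with hΦ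
  have hΦm : Measurable Φ := Measurable.mul (by fun_prop) (hF.comp measurable_snd)
  have hpair : Measurable fun M : HermitianMat N => (realDiag M, sortedEigenvalues M.2) :=
    (continuous_realDiag N).measurable.prodMk (continuous_sortedEigenvalues N).measurable
  have hΔ : Measurable fun p : (Fin N → ℝ) × (Fin N → ℝ) =>
      ENNReal.ofReal (vandermondeDelta p.2) :=
    ENNReal.measurable_ofReal.comp ((measurable_vandermondeDelta N).comp measurable_snd)
  have hΔc : Measurable fun x : Fin N → ℝ => ((vandermondeDelta x : ℝ) : ℂ) * F x :=
    (Complex.measurable_ofReal.comp (measurable_vandermondeDelta N)).mul hF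
  have hae : (fun p => (ENNReal.ofReal (vandermondeDelta p.2)).toReal • Φ p)
      =ᵐ[patternMeasure N] fun p => Complex.exp (∑ i, z i * p.1 i) *
        (((vandermondeDelta p.2 : ℝ) : ℂ) * F p.2) := by
    filter_upwards [ae_strictMono_patternMeasure N] with p hp
    rw [ENNReal.toReal_ofReal (vandermondeDelta_pos hp).le, Complex.real_smul, hΦ]
    ring
  have hint := integrable_exp_mul_patternMeasure z hΔc hmom
  have hlt : ∀ᵐ p ∂patternMeasure N, ENNReal.ofReal (vandermondeDelta p.2) < ⊤ :=
    Filter.Eventually.of_forall fun _ => ENNReal.ofReal_lt_top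
  constructor
  · have h : Integrable Φ (Measure.map
        (fun M : HermitianMat N => (realDiag M, sortedEigenvalues M.2)) (hermitianVolume N)) := by
      rw [map_realDiag_sortedEigenvalues]
      refine Integrable.smul_measure ?_ (by simp)
      rw [integrable_withDensity_iff_integrable_smul' hΔ hlt]
      exact hint.congr hae.symm
    exact h.comp_measurable hpair
  · have h : ∫ M : HermitianMat N, Φ (realDiag M, sortedEigenvalues M.2) ∂hermitianVolume N =
        ∫ p, Φ p ∂(Measure.map (fun M : HermitianMat N => (realDiag M, sortedEigenvalues M.2))
          (hermitianVolume N)) :=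
      (integral_map hpair.aemeasurable hΦm.aestronglyMeasurable).symm
    refine h.trans ?_
    rw [map_realDiag_sortedEigenvalues, integral_smul_measure,
      integral_withDensity_eq_integral_toReal_smul hΔ hlt, integral_congr_ae hae,
      integral_exp_mul_patternMeasure N hz hΔc hmom, ENNReal.toReal_pow,
      ENNReal.toReal_ofReal Real.pi_pos.le, Complex.real_smul, Complex.ofReal_pow]

end HermitianTransform

/-! ### From ordered families to all families -/

section Chambers

variable {N : ℕ}

theorem ae_injective (N : ℕ) : ∀ᵐ x : Fin N → ℝ, Function.Injective x := by
  have h : ∀ i j : Fin N, i ≠ j → ∀ᵐ x : Fin N → ℝ, x i ≠ x j := by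
    intro i j hij
    let L : (Fin N → ℝ) →ₗ[ℝ] ℝ := LinearMap.proj (R := ℝ) (φ := fun _ : Fin N => ℝ) i -
      LinearMap.proj (R := ℝ) (φ := fun _ : Fin N => ℝ) j
    have hL : LinearMap.ker L ≠ ⊤ := by
      intro h
      have h1 : (Pi.single i 1 : Fin N → ℝ) ∈ LinearMap.ker L := h ▸ Submodule.mem_top
      rw [LinearMap.mem_ker] at h1
      simp [L, Pi.single_eq_of_ne hij.symm] at h1
    have h0 := Measure.addHaar_submodule (volume : Measure (Fin N → ℝ)) _ hL
    rw [ae_iff]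
    convert h0 using 2
    ext x
    simp [L, sub_eq_zero]
  have h' : ∀ᵐ x : Fin N → ℝ, ∀ i j : Fin N, i ≠ j → x i ≠ x j := by
    rw [ae_all_iff]; intro i
    rw [ae_all_iff]; intro j
    by_cases hij : i = j
    · exact Filter.Eventually.of_forall fun x h => absurd hij h
    · filter_upwards [h i j hij] with x hx _ using hx
  filter_upwards [h'] with x hx i j hxij
  by_contra hij
  exact hx i j hij hxij

theorem measurePreserving_comp_perm (σ : Equiv.Perm (Fin N)) :
    MeasurePreserving fun x : Fin N → ℝ => x ∘ σ := by
  have h := volume_measurePreserving_piCongrLeft (fun _ : Fin N => ℝ) σ.symm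
  have heq : (MeasurableEquiv.piCongrLeft (fun _ : Fin N => ℝ) σ.symm : (Fin N → ℝ) → _) =
      fun x => x ∘ σ := by
    funext x i
    have := Equiv.piCongrLeft_apply_apply (fun _ : Fin N => ℝ) σ.symm x (σ i)
    rw [Equiv.symm_apply_apply] at this
    exact this
  rwa [heq] at h

theorem existsUnique_perm_strictMono {x : Fin N → ℝ} (hx : Function.Injective x) :
    ∃! σ : Equiv.Perm (Fin N), StrictMono (x ∘ σ) := by
  refine ⟨Tuple.sort x, (Tuple.monotone_sort x).strictMono_of_injective
    (hx.comp (Tuple.sort x).injective), fun τ hτ => ?_⟩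
  have := Tuple.unique_monotone hτ.monotone (Tuple.monotone_sort x)
  ext i
  exact congrArg _ (hx (congrFun this i))

/-- The permuted copies of the chamber of ordered families tile the space. -/
theorem sum_integral_strictMono_comp_perm {K : (Fin N → ℝ) → ℂ} (hK : Integrable K) :
    ∑ σ : Equiv.Perm (Fin N), ∫ x in {x : Fin N → ℝ | StrictMono x}, K (x ∘ σ) = ∫ x, K x := by
  have hW := (isOpen_setOf_strictMono N).measurableSet
  have hWσ : ∀ σ : Equiv.Perm (Fin N), MeasurableSet {x : Fin N → ℝ | StrictMono (x ∘ σ)} :=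
    fun σ => hW.preimage (measurePreserving_comp_perm σ).measurable
  have h1 : ∀ σ : Equiv.Perm (Fin N), ∫ x in {x : Fin N → ℝ | StrictMono x}, K (x ∘ σ) =
      ∫ x, Set.indicator {x : Fin N → ℝ | StrictMono (x ∘ σ.symm)} K x := by
    intro σ
    have hmp := measurePreserving_comp_perm σ
    have hemb : MeasurableEmbedding fun x : Fin N → ℝ => x ∘ σ := by
      refine MeasurableEquiv.measurableEmbedding
        ⟨⟨fun x => x ∘ σ, fun x => x ∘ σ.symm, fun x => ?_, fun x => ?_⟩, hmp.measurable,
          (measurePreserving_comp_perm σ.symm).measurable⟩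
      · funext i; simp
      · funext i; simp
    rw [← hmp.integral_comp hemb, ← integral_indicator hW]
    refine integral_congr_ae (Filter.Eventually.of_forall fun x => ?_)
    have hx : (x ∘ σ) ∘ σ.symm = x := by funext i; simp
    by_cases h : StrictMono x
    · simp only
      rw [Set.indicator_of_mem (by exact h), Set.indicator_of_mem]
      simpa [hx] using h
    · simp only
      rw [Set.indicator_of_notMem (by exact h), Set.indicator_of_notMem]
      simpa [hx] using h
  simp only [h1]
  rw [← integral_finsetSum _ fun σ _ => hK.indicator (hWσ σ.symm)]
  refine integral_congr_ae ?_
  filter_upwards [ae_injective N] with x hx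
  obtain ⟨σ, hσ, huniq⟩ := existsUnique_perm_strictMono hx
  rw [Finset.sum_eq_single σ.symm]
  · exact Set.indicator_of_mem (by simpa using hσ) K
  · intro τ _ hτ
    refine Set.indicator_of_notMem (fun h => hτ ?_) K
    rw [← huniq τ.symm h]; simp
  · simp

theorem vandermondeDelta_comp_perm {R : Type*} [CommRing R] (u : Fin N → R)
    (σ : Equiv.Perm (Fin N)) :
    vandermondeDelta (u ∘ σ) = (Equiv.Perm.sign σ : ℤ) * vandermondeDelta u := by
  have h : Matrix.vandermonde (u ∘ σ) = (Matrix.vandermonde u).submatrix σ id := by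
    ext i j; simp [Matrix.vandermonde_apply]
  rw [vandermondeDelta, h, Matrix.det_permute, vandermondeDelta]

/-- Integration over ordered families of the product of two alternating determinants, one of them
of Vandermonde type. -/
theorem integral_det_expMatrix_mul_vandermonde (z : Fin N → ℂ) {w : ℝ → ℂ}
    (hw : ∀ ν : ℂ, Integrable fun t : ℝ => Complex.exp (ν * t) * w t) :
    ∫ x in {x : Fin N → ℝ | StrictMono x}, (expMatrix z x).det *
        ((∏ i, w (x i)) * vandermondeDelta fun i => Complex.exp (x i)) =
      (Matrix.of fun j k : Fin N => ∫ t : ℝ, Complex.exp ((z j + (k : ℕ)) * t) * w t).det := by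
  set f : Fin N → Fin N → ℝ → ℂ := fun k j t => Complex.exp ((z j + (k : ℕ)) * t) * w t with hf
  set K : (Fin N → ℝ) → ℂ := fun x => (Matrix.of fun k j => f k j (x j)).det with hK
  have hKint : Integrable K := integrable_det_pi (μ := fun _ => volume) fun k j => hw _
  have hKeq : ∀ x, K x = (∏ j, Complex.exp (z j * x j)) *
      ((∏ i, w (x i)) * vandermondeDelta fun i => Complex.exp (x i)) := by
    intro x
    have : (Matrix.of fun k j => f k j (x j)) = Matrix.of fun k j =>
        (fun j => Complex.exp (z j * x j) * w (x j)) j *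
          (Matrix.vandermonde fun i => Complex.exp (x i))ᵀ k j := by
      ext k j
      simp only [Matrix.of_apply, Matrix.transpose_apply, Matrix.vandermonde_apply, hf]
      rw [add_mul, Complex.exp_add, Complex.exp_nat_mul]
      ring
    rw [hK]
    simp only
    rw [this, Matrix.det_mul_row, Matrix.det_transpose, Finset.prod_mul_distrib, vandermondeDelta]
    ring
  have hexpand : ∀ x : Fin N → ℝ, (expMatrix z x).det *
        ((∏ i, w (x i)) * vandermondeDelta fun i => Complex.exp (x i)) =
      ∑ σ : Equiv.Perm (Fin N), K (x ∘ σ) := by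
    intro x
    rw [Matrix.det_apply', Finset.sum_mul, ← Equiv.sum_comp (Equiv.inv _)]
    refine Finset.sum_congr rfl fun σ _ => ?_
    have h1 : ∏ i, expMatrix z x ((Equiv.inv _ σ) i) i = ∏ j, Complex.exp (z j * x (σ j)) := by
      rw [← Equiv.prod_comp σ]
      simp [expMatrix]
    have h2 : ∏ i, w ((x ∘ σ) i) = ∏ i, w (x i) := Equiv.prod_comp σ fun i => w (x i)
    have h3 : vandermondeDelta (fun i => Complex.exp ((x ∘ σ) i : ℝ)) =
        (Equiv.Perm.sign σ : ℤ) * vandermondeDelta fun i => Complex.exp (x i) :=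
      vandermondeDelta_comp_perm (fun i => Complex.exp (x i)) σ
    rw [hKeq, h1, h2, h3]
    simp only [Equiv.inv_apply, Equiv.Perm.sign_inv, Function.comp_apply]
    ring
  simp only [hexpand]
  have hKσ : ∀ σ : Equiv.Perm (Fin N), Integrable (fun x => K (x ∘ σ)) := fun σ =>
    (measurePreserving_comp_perm σ).integrable_comp_of_integrable hKint
  rw [integral_finsetSum _ fun σ _ => (hKσ σ).integrableOn, sum_integral_strictMono_comp_perm hKint,
    ← Matrix.det_transpose]
  exact integral_det_pi (μ := fun _ => volume) (f := f) fun k j => hw _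

end Chambers

/-! ### Bessel functions and the hyperbolic weight -/

section Bessel

theorem sq_div_four_le_cosh (t : ℝ) : t ^ 2 / 4 ≤ Real.cosh t := by
  rw [← Real.cosh_abs, ← sq_abs, Real.cosh_eq]
  have h1 := Real.quadratic_le_exp_of_nonneg (abs_nonneg t)
  have h2 := Real.exp_pos (-|t|)
  have h3 := abs_nonneg t
  linarith

/-- The weight `exp (-b cosh t)` decays faster than any exponential. -/
theorem integrable_exp_abs_sub_cosh {b : ℝ} (hb : 0 < b) (c : ℝ) :
    Integrable fun t : ℝ => Real.exp (c * |t| - b * Real.cosh t) := by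
  have hg : Integrable fun t : ℝ => Real.exp (2 * c ^ 2 / b) * Real.exp (-(b / 8) * t ^ 2) :=
    (integrable_exp_neg_mul_sq (by positivity)).const_mul _
  refine hg.mono' (Continuous.aestronglyMeasurable (by fun_prop))
    (Filter.Eventually.of_forall fun t => ?_)
  rw [Real.norm_eq_abs, abs_of_pos (Real.exp_pos _), ← Real.exp_add]
  refine Real.exp_le_exp.mpr ?_
  have h1 := mul_le_mul_of_nonneg_left (sq_div_four_le_cosh t) hb.le
  -- the arithmetic-geometric mean inequality absorbs the linear term into the quadratic one
  have h2 : c * |t| ≤ 2 * c ^ 2 / b + b / 8 * t ^ 2 := by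
    have h3 : 2 * c ^ 2 / b + b / 8 * t ^ 2 - c * |t| = (4 * c - b * |t|) ^ 2 / (8 * b) := by
      rw [← sq_abs t]; field_simp; ring
    have h4 : 0 ≤ (4 * c - b * |t|) ^ 2 / (8 * b) := by positivity
    linarith
  linarith

theorem integrable_exp_mul_exp_cosh {b : ℝ} (hb : 0 < b) (ν : ℂ) :
    Integrable fun t : ℝ => Complex.exp (ν * t) * Complex.exp (-b * Complex.cosh t) := by
  refine (integrable_exp_abs_sub_cosh hb ‖ν‖).mono' (Continuous.aestronglyMeasurable (by fun_prop))
    (Filter.Eventually.of_forall fun t => ?_)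
  rw [← Complex.exp_add, Complex.norm_exp, Complex.add_re]
  refine Real.exp_le_exp.mpr ?_
  have h1 : (-b * Complex.cosh t : ℂ).re = -(b * Real.cosh t) := by
    rw [← Complex.ofReal_cosh, ← Complex.ofReal_neg, ← Complex.ofReal_mul, Complex.ofReal_re]
    ring
  have h2 : (ν * t).re ≤ ‖ν‖ * |t| := by
    refine (Complex.re_le_norm _).trans ?_
    rw [norm_mul, Complex.norm_real, Real.norm_eq_abs]
  linarith

/-- The two-sided integral representation of the modified Bessel function. -/
theorem integral_exp_mul_exp_cosh {b : ℝ} (hb : 0 < b) (ν : ℂ) :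
    ∫ t : ℝ, Complex.exp (ν * t) * Complex.exp (-b * Complex.cosh t) = 2 * besselK ν b := by
  have hint := integrable_exp_mul_exp_cosh hb ν
  rw [← intervalIntegral.integral_Iic_add_Ioi (b := 0) hint.integrableOn hint.integrableOn]
  have hneg := integral_comp_neg_Ioi (0 : ℝ)
    (fun t : ℝ => Complex.exp (ν * t) * Complex.exp (-b * Complex.cosh t))
  rw [neg_zero] at hneg
  rw [← hneg, ← integral_add hint.comp_neg.integrableOn hint.integrableOn, besselK,
    ← integral_const_mul]
  refine integral_congr_ae (Filter.Eventually.of_forall fun t => ?_)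
  simp only
  rw [Complex.ofReal_neg, Complex.cosh_neg, Complex.cosh.eq_1 (ν * t)]
  ring_nf

end Bessel

/-! ### The integrand as a function of the diagonal and the spectrum -/

section CoshModel

variable {N : ℕ}

/-- The spectral part `exp (-b ∑ cosh xᵢ) Δ(e^x) / Δ(x)` of the integrand. -/
noncomputable def coshWeight (b : ℝ) (x : Fin N → ℝ) : ℂ :=
  (∏ i, Complex.exp (-b * Complex.cosh (x i))) *
    ((vandermondeDelta (fun i => Real.exp (x i)) / vandermondeDelta x : ℝ) : ℂ)

theorem measurable_coshWeight (b : ℝ) : Measurable (coshWeight (N := N) b) := by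
  refine Measurable.mul (by fun_prop) (Complex.measurable_ofReal.comp (Measurable.div ?_
    (measurable_vandermondeDelta N)))
  exact (measurable_vandermondeDelta N).comp (by fun_prop)

theorem vandermondeDelta_mul_coshWeight (b : ℝ) {x : Fin N → ℝ} (hx : StrictMono x) :
    ((vandermondeDelta x : ℝ) : ℂ) * coshWeight b x =
      (∏ i, Complex.exp (-b * Complex.cosh (x i))) *
        vandermondeDelta fun i => Complex.exp (x i) := by
  have h0 : ((vandermondeDelta x : ℝ) : ℂ) ≠ 0 :=
    Complex.ofReal_ne_zero.mpr (vandermondeDelta_pos hx).ne'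
  have h1 : ((vandermondeDelta (fun i => Real.exp (x i)) : ℝ) : ℂ) =
      vandermondeDelta fun i => Complex.exp (x i) := by
    simp [vandermondeDelta, Matrix.det_vandermonde]
  rw [coshWeight, Complex.ofReal_div, h1]
  field_simp

theorem abs_vandermondeDelta_exp_le {x : Fin N → ℝ} (hx : StrictMono x) :
    |vandermondeDelta fun i => Real.exp (x i)| ≤
      Real.exp ((∑ i : Fin N, ((Finset.Ioi i).card : ℝ)) * ∑ i, |x i|) := by
  rw [vandermondeDelta, Matrix.det_vandermonde, Finset.abs_prod, Finset.sum_mul, Real.exp_sum]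
  refine Finset.prod_le_prod (fun i _ => abs_nonneg _) fun i _ => ?_
  rw [Finset.abs_prod]
  refine (Finset.prod_le_prod (fun j _ => abs_nonneg _)
    (g := fun _ => Real.exp (∑ i, |x i|)) fun j hj => ?_).trans ?_
  · have h1 : Real.exp (x i) < Real.exp (x j) := Real.exp_lt_exp.mpr (hx (Finset.mem_Ioi.mp hj))
    have h2 : x j ≤ ∑ i, |x i| := (le_abs_self _).trans
      (Finset.single_le_sum (f := fun i => |x i|) (fun _ _ => abs_nonneg _) (Finset.mem_univ j))
    have h3 := Real.exp_le_exp.mpr h2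
    have h4 := Real.exp_pos (x i)
    rw [abs_of_pos (sub_pos.mpr h1)]
    linarith
  · rw [Finset.prod_const, ← Real.exp_nat_mul]

theorem hasExpMoments_coshWeight {b : ℝ} (hb : 0 < b) :
    HasExpMoments fun x : Fin N → ℝ => ((vandermondeDelta x : ℝ) : ℂ) * coshWeight b x := by
  intro C hC
  set D : ℝ := ∑ i : Fin N, ((Finset.Ioi i).card : ℝ)
  have hint : Integrable fun x : Fin N → ℝ =>
      ∏ i, Real.exp ((C + D) * |x i| - b * Real.cosh (x i)) :=
    Integrable.fintype_prod (f := fun _ t => Real.exp ((C + D) * |t| - b * Real.cosh t))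
      fun _ => integrable_exp_abs_sub_cosh hb _
  refine lt_of_le_of_lt ?_ hint.2
  refine (setLIntegral_mono' (isOpen_setOf_strictMono N).measurableSet fun x hx => ?_).trans
    (setLIntegral_le_lintegral _ _)
  beta_reduce
  rw [vandermondeDelta_mul_coshWeight b hx, ← ofReal_norm, ← ofReal_norm,
    ← ENNReal.ofReal_mul (Real.exp_pos _).le]
  refine ENNReal.ofReal_le_ofReal ?_
  have h1 : ‖∏ i, Complex.exp (-b * Complex.cosh (x i))‖ = Real.exp (-(b * ∑ i, Real.cosh (x i))) := by
    rw [norm_prod, Finset.mul_sum, ← Finset.sum_neg_distrib, Real.exp_sum]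
    refine Finset.prod_congr rfl fun i _ => ?_
    rw [Complex.norm_exp, ← Complex.ofReal_cosh, ← Complex.ofReal_neg, ← Complex.ofReal_mul,
      Complex.ofReal_re, neg_mul]
  have h2 : ‖vandermondeDelta fun i => Complex.exp (x i)‖ =
      |vandermondeDelta fun i => Real.exp (x i)| := by
    rw [← Real.norm_eq_abs, ← Complex.norm_real]
    congr 1
    simp [vandermondeDelta, Matrix.det_vandermonde]
  have h3 : ‖∏ i, Real.exp ((C + D) * |x i| - b * Real.cosh (x i))‖ =
      Real.exp (C * ∑ i, |x i|) * (Real.exp (-(b * ∑ i, Real.cosh (x i))) *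
        Real.exp (D * ∑ i, |x i|)) := by
    rw [← Real.exp_sum, Real.norm_eq_abs, abs_of_pos (Real.exp_pos _), ← Real.exp_add,
      ← Real.exp_add, Finset.sum_sub_distrib, ← Finset.mul_sum, ← Finset.mul_sum]
    congr 1; ring
  rw [norm_mul, h1, h2, h3]
  exact mul_le_mul_of_nonneg_left (mul_le_mul_of_nonneg_left (abs_vandermondeDelta_exp_le hx)
    (Real.exp_pos _).le) (Real.exp_pos _).le

/-- The integrand depends on the matrix only through its diagonal and its ordered eigenvalues. -/
theorem coshModelIntegrand_eq (ε : ℝ) (z : Fin N → ℂ) (M : HermitianMat N) :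
    coshModelIntegrand ε z M = Complex.exp (∑ i, z i * realDiag M i) *
      coshWeight (2 / ε) (sortedEigenvalues M.2) := by
  have h1 : (Matrix.diagonal z * M.1).trace = ∑ i, z i * realDiag M i := by
    simp only [Matrix.trace, Matrix.diag_apply, Matrix.diagonal_mul]
    refine Finset.sum_congr rfl fun i _ => ?_
    rw [realDiag]
    congr 1
    exact (M.2.coe_re_apply_self i).symm
  rw [coshModelIntegrand, Matrix.trace_sub, Matrix.trace_smul, trace_coshMat M.2, h1, sub_eq_add_neg,
    Complex.exp_add, mul_assoc, coshWeight, Matrix.IsHermitian.delta, Matrix.IsHermitian.delta,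
    sortedEigenvalues_exp M.2]
  congr 2
  rw [← Complex.exp_sum]
  congr 1
  simp [Finset.mul_sum]

end CoshModel

theorem mainTheorem5 (N : ℕ) (ε : ℝ) (hε : 0 < ε) (z : Fin N → ℂ)
    (hz : Function.Injective z) :
    Integrable (coshModelIntegrand ε z) (hermitianVolume N) ∧
    ∫ M, coshModelIntegrand ε z M ∂(hermitianVolume N) =
      2 ^ N * (Real.pi : ℂ) ^ (N * (N - 1) / 2) *
        (Matrix.of fun j k : Fin N => besselK (z j + (k : ℕ)) ((2 / ε : ℝ) : ℂ)).det /
          vandermondeDelta z := by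
  have hb : 0 < 2 / ε := by positivity
  have hmain := integral_exp_mul_sortedEigenvalues hz (measurable_coshWeight (2 / ε))
    (hasExpMoments_coshWeight hb)
  have hfun : coshModelIntegrand ε z = fun M : HermitianMat N =>
      Complex.exp (∑ i, z i * realDiag M i) * coshWeight (2 / ε) (sortedEigenvalues M.2) :=
    funext (coshModelIntegrand_eq ε z)
  rw [hfun]
  refine ⟨hmain.1, hmain.2.trans ?_⟩
  have hset : ∫ x in {x : Fin N → ℝ | StrictMono x}, (expMatrix z x).det *
        (((vandermondeDelta x : ℝ) : ℂ) * coshWeight (2 / ε) x) =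
      ∫ x in {x : Fin N → ℝ | StrictMono x}, (expMatrix z x).det *
        ((∏ i, Complex.exp (-(2 / ε : ℝ) * Complex.cosh (x i))) *
          vandermondeDelta fun i => Complex.exp (x i)) :=
    setIntegral_congr_fun (isOpen_setOf_strictMono N).measurableSet fun x hx => by
      simp only [vandermondeDelta_mul_coshWeight (2 / ε) hx]
  have hdet : (Matrix.of fun j k : Fin N => (2 : ℂ) *
      besselK (z j + (k : ℕ)) ((2 / ε : ℝ) : ℂ)).det = 2 ^ N *
        (Matrix.of fun j k : Fin N => besselK (z j + (k : ℕ)) ((2 / ε : ℝ) : ℂ)).det := by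
    have := Matrix.det_smul
      (Matrix.of fun j k : Fin N => besselK (z j + (k : ℕ)) ((2 / ε : ℝ) : ℂ)) 2
    rw [Fintype.card_fin] at this
    exact this
  rw [hset, integral_det_expMatrix_mul_vandermonde z (integrable_exp_mul_exp_cosh hb)]
  simp only [integral_exp_mul_exp_cosh hb]
  rw [hdet]
  ring
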